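/- Let $M$ be a lattice (a free abelian group of finite rank), let $Q\subset M\otimes\mathbb{R}$ be a nonempty lattice polytope (the convex hull of a nonempty finite subset of $M$), and let $\lambda\in M^*=\operatorname{Hom}(M,\mathbb{Z})$ be a linear form, extended linearly to $M\otimes\mathbb{R}$. Assume that - (Positivity) $\lambda(x)\ge 0$ for every vertex $x$ of $Q$; - (Genericity) $\lambda(x)\neq\lambda(y)$ whenever $x$ and $y$ are the two ends of an edge of $Q$. Let $q$ be an indeterminate. For $n\in\mathbb{Z}_{\ge 0}$ put $[n]_q=\frac{q^n-1}{q-1}$ and $W_\lambda(nQ,q)=\sum_{v\in nQ\cap M}q^{\lambda(v)}$. Let $m=\max_{Q}\lambda$, which is a nonnegative integer. Then there is a polynomial $L_{Q,\lambda}\in\mathbb{Q}(q)[x]$ such that $$L_{Q,\lambda}([n]_q)=W_\lambda(nQ,q)\qquad\text{for all integers } n\ge 0.$$ Its degree is $m$, and every pole $q=z\in\mathbb{C}$ of every coefficient of $L_{Q,\lambda}$ is a root of unity of order at most $m$ (that is, a primitive $k$-th root of unity for some $1\le k\le m$). -/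

import Mathlib

open scoped TensorProduct Pointwise

noncomputable section

namespace QEhrhart

variable {M : Type*} [AddCommGroup M]

/-- The embedding of the lattice `M` into its ambient real vector space `ℝ ⊗ M`. -/
def latticeEmb (M : Type*) [AddCommGroup M] : M →ₗ[ℤ] ℝ ⊗[ℤ] M :=
  TensorProduct.mk ℤ ℝ M 1

/-- Lattice polytopes: convex hulls of nonempty finite sets of lattice points. -/
def IsLatticePolytope (Q : Set (ℝ ⊗[ℤ] M)) : Prop :=
  ∃ S : Finset M, S.Nonempty ∧ Q = convexHull ℝ (latticeEmb M '' (S : Set M))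

/-- The real extension `ℝ ⊗ M → ℝ` of an integral linear form on `M`. -/
def realForm (lam : Module.Dual ℤ M) : Module.Dual ℝ (ℝ ⊗[ℤ] M) :=
  Module.Dual.baseChange ℝ lam

/-- `x` and `y` are the two ends of an edge of `Q`: they are distinct and the segment
joining them is a face of `Q`. (The faces of a polytope are its convex extreme subsets, and its
edges are its one-dimensional faces, which are segments.) -/
def IsEdge (Q : Set (ℝ ⊗[ℤ] M)) (x y : ℝ ⊗[ℤ] M) : Prop :=
  x ≠ y ∧ IsExtreme ℝ Q (segment ℝ x y)

/-- Positivity: `λ ≥ 0` at every vertex of `Q`. -/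
def Positivity (Q : Set (ℝ ⊗[ℤ] M)) (lam : Module.Dual ℤ M) : Prop :=
  ∀ x ∈ Set.extremePoints ℝ Q, 0 ≤ realForm lam x

/-- Genericity: `λ` takes different values at the two ends of every edge of `Q`. -/
def Genericity (Q : Set (ℝ ⊗[ℤ] M)) (lam : Module.Dual ℤ M) : Prop :=
  ∀ x y, IsEdge Q x y → realForm lam x ≠ realForm lam y

/-- The lattice points that lie in a subset of the ambient space. -/
def latticePoints (P : Set (ℝ ⊗[ℤ] M)) : Set M :=
  {v | latticeEmb M v ∈ P}

/-- The weighted sum `W_λ(P, q) = ∑ q ^ λ(v)` over the lattice points `v` of `P`, in `ℚ(q)`.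
The sum is finite for `P = n Q` with `Q` a lattice polytope, by `finite_latticePoints_smul`. -/
def weightedSum (lam : Module.Dual ℤ M) (P : Set (ℝ ⊗[ℤ] M)) : RatFunc ℚ :=
  ∑ᶠ v ∈ latticePoints P, (RatFunc.X : RatFunc ℚ) ^ (lam v)

/-- The `q`-integer `[n]_q = (q ^ n - 1) / (q - 1)` in `ℚ(q)`. -/
def qInt (n : ℕ) : RatFunc ℚ :=
  ((RatFunc.X : RatFunc ℚ) ^ n - 1) / (RatFunc.X - 1)

/-- The complex number `z` is a pole of `c ∈ ℚ(q)`: it is a root of the denominator of `c`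
in lowest terms. -/
def IsPole (c : RatFunc ℚ) (z : ℂ) : Prop :=
  Polynomial.aeval z c.denom = 0

/-- The dilates of a lattice polytope contain finitely many lattice points. -/
theorem finite_latticePoints_smul [Module.Free ℤ M] [Module.Finite ℤ M]
    {Q : Set (ℝ ⊗[ℤ] M)} (hQ : IsLatticePolytope Q) (n : ℕ) :
    (latticePoints ((n : ℝ) • Q)).Finite := by
  obtain ⟨S, hS, rfl⟩ := hQ
  let b := Module.Free.chooseBasis ℤ M
  obtain ⟨B, hB⟩ : ∃ B : ℤ, ∀ s ∈ S, ∀ i, |b.repr s i| ≤ B := by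
    refine ⟨∑ s ∈ S, ∑ i, |b.repr s i|, fun s hs i => ?_⟩
    calc |b.repr s i| ≤ ∑ i, |b.repr s i| :=
          Finset.single_le_sum (f := fun i => |b.repr s i|)
            (fun _ _ => abs_nonneg _) (Finset.mem_univ i)
      _ ≤ _ := Finset.single_le_sum (f := fun s => ∑ i, |b.repr s i|)
            (fun _ _ => Finset.sum_nonneg fun _ _ => abs_nonneg _) hs
  have hform : ∀ (i) (v : M), realForm (b.coord i) (latticeEmb M v) = (b.repr v i : ℝ) := by
    intro i v
    change Module.Dual.baseChange ℝ (b.coord i) ((1 : ℝ) ⊗ₜ[ℤ] v) = _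
    rw [Module.Dual.baseChange_apply_tmul]
    simp
  have hbox : ∀ i, ∀ x ∈ convexHull ℝ (latticeEmb M '' (S : Set M)),
      realForm (b.coord i) x ∈ Set.Icc (-(B : ℝ)) B := by
    intro i x hx
    have hc : Convex ℝ ((realForm (b.coord i)) ⁻¹' Set.Icc (-(B : ℝ)) B) :=
      (convex_Icc _ _).linear_preimage _
    refine convexHull_min ?_ hc hx
    rintro _ ⟨s, hs, rfl⟩
    have h := abs_le.mp (hB s hs i)
    simp only [Set.mem_preimage, hform, Set.mem_Icc]
    exact ⟨by exact_mod_cast h.1, by exact_mod_cast h.2⟩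
  have hfin : (Set.univ.pi fun _ : Module.Free.ChooseBasisIndex ℤ M =>
      Set.Icc (-(n * B) : ℤ) (n * B)).Finite :=
    Set.Finite.pi fun _ => Set.finite_Icc _ _
  refine (hfin.preimage (f := b.equivFun) b.equivFun.injective.injOn).subset ?_
  rintro v ⟨x, hx, hxv⟩
  simp only [Set.mem_preimage, Set.mem_pi, Set.mem_univ, true_imp_iff, Set.mem_Icc]
  intro i
  have h1 : (b.repr v i : ℝ) = n * realForm (b.coord i) x := by
    rw [← hform, ← hxv]; simp
  have h2 := hbox i x hx
  have hn : (0 : ℝ) ≤ n := Nat.cast_nonneg n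
  have h3 := mul_le_mul_of_nonneg_left h2.1 hn
  have h4 := mul_le_mul_of_nonneg_left h2.2 hn
  rw [← h1] at h3 h4
  rw [Module.Basis.equivFun_apply]
  constructor
  · have : ((-(n * B) : ℤ) : ℝ) ≤ (b.repr v i : ℝ) := by push_cast; linarith
    exact_mod_cast this
  · exact_mod_cast h4

end QEhrhart

end

open scoped TensorProduct Pointwise

noncomputable section

/-! List the points of `S` as s_0, ..., s_r by increasing λ. Among the nonnegative coefficient
vectors with a given sum and a given image there is exactly one that is lexicographically largest;
the supports of such vectors are the cells of a pulling triangulation (`exists_isCell_support`,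
`IsCell.unique`). Genericity makes λ injective on each cell (`IsCell.injOn`).

Every cell may be enlarged by the vertex 0, so the cone over Q splits into half-open simplicial
cones. Taking integer parts of the coordinates writes each lattice point of nQ uniquely as a box
point plus a natural combination of vertices. Hence W_λ(nQ,q) is a finite sum of terms q^λ(v)
h_{n-h}(q^λ(s_i)), with h_N complete homogeneous (`weightedSum_eq_sum_box`). On a cell the q^λ(s_i)
are distinct, so h_N is a combination of their powers (`completeHomog_eq_sum`), and q^(nλ(s_i)) = (1
+ (q-1)[n]_q)^λ(s_i) is a polynomial in [n]_q of degree at most m.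

The denominators are products of differences q^λ(s_i) - q^λ(s_j), that is, up to sign, powers of q
times factors q^d - 1 with 1 ≤ d ≤ m. The powers of q are absorbed because box coordinates lie in
[0,1] (`IsBoxPoint.boxCoeff_mem`). The degree is not less than m: the point n s_r gives W degree at
least nm in q, while a polynomial of degree below m evaluated at [n]_q has q-degree at most n(m-1)
plus a constant. -/

namespace QEhrhart

/-! ### Pulling triangulations and faces in terms of affine dependencies. -/

section PointConfiguration

variable {E : Type*} [AddCommGroup E] [Module ℝ E] {n : ℕ}

/-- The affine dependencies of a configuration of points. -/
def affineDeps (p : Fin n → E) : Submodule ℝ (Fin n → ℝ) where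
  carrier := {k | ∑ i, k i = 0 ∧ ∑ i, k i • p i = 0}
  add_mem' := by
    rintro a b ⟨h1, h2⟩ ⟨h3, h4⟩
    exact ⟨by simp [Finset.sum_add_distrib, h1, h3],
      by simp [add_smul, Finset.sum_add_distrib, h2, h4]⟩
  zero_mem' := by simp
  smul_mem' := by
    rintro c a ⟨h1, h2⟩
    exact ⟨by simp [← Finset.mul_sum, h1], by simp [mul_smul, ← Finset.smul_sum, h2]⟩

theorem sub_mem_affineDeps {p : Fin n → E} {c d : Fin n → ℝ} (h1 : ∑ i, c i = ∑ i, d i)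
    (h2 : ∑ i, c i • p i = ∑ i, d i • p i) : c - d ∈ affineDeps p := by
  constructor
  · simp [h1]
  · simp [sub_smul, h2]

/-- The first nonzero coordinate exists and is positive. -/
def LexPos (k : Fin n → ℝ) : Prop := ∃ i, 0 < k i ∧ ∀ j < i, k j = 0

theorem lexPos_or_lexPos_neg {k : Fin n → ℝ} (hk : k ≠ 0) : LexPos k ∨ LexPos (-k) := by
  have hne : (Finset.univ.filter fun i => k i ≠ 0).Nonempty := by
    obtain ⟨i, hi⟩ := Function.ne_iff.mp hk
    exact ⟨i, by simpa using hi⟩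
  obtain ⟨i, hi, hmin⟩ := Finset.exists_minimal hne
  have hz : ∀ j < i, k j = 0 := by
    intro j hj
    by_contra h
    exact absurd (hmin (by simpa using h) hj.le) (not_le.mpr hj)
  have hi' : k i ≠ 0 := by simpa using hi
  rcases lt_or_gt_of_ne hi' with h | h
  · exact Or.inr ⟨i, by simpa using h, fun j hj => by simp [hz j hj]⟩
  · exact Or.inl ⟨i, h, hz⟩

/-- The cells of the pulling triangulation: sets supporting lexicographically maximal
coefficient vectors. -/
def IsCell (p : Fin n → E) (B : Set (Fin n)) : Prop :=
  ∀ k ∈ affineDeps p, (∀ i ∉ B, 0 ≤ k i) → ¬ LexPos k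

theorem IsCell.mono {p : Fin n → E} {B B' : Set (Fin n)} (h : IsCell p B') (hB : B ⊆ B') :
    IsCell p B :=
  fun k hk hk' => h k hk fun i hi => hk' i fun hi' => hi (hB hi')

/-- A lexicographically positive vector is nonnegative at coordinate 0 anyway, so dropping the sign
condition there changes nothing. -/
theorem IsCell.insert_zero {p : Fin (n + 1) → E} {B : Set (Fin (n + 1))} (h : IsCell p B) :
    IsCell p (insert 0 B) := by
  rintro k hk hk' ⟨i, hi, hlt⟩
  refine h k hk (fun j hj => ?_) ⟨i, hi, hlt⟩
  rcases eq_or_ne j 0 with rfl | hj0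
  · rcases (Fin.zero_le i).eq_or_lt with rfl | h0
    · exact hi.le
    · exact (hlt 0 h0).ge
  · exact hk' j (by simp [hj0, hj])

/-- If c ≠ d, then c - d or d - c is lexicographically positive, and each is nonnegative off the
support of the vector subtracted. -/
theorem IsCell.unique {p : Fin n → E} {c d : Fin n → ℝ} (hc0 : 0 ≤ c) (hd0 : 0 ≤ d)
    (hc : IsCell p c.support) (hd : IsCell p d.support)
    (h1 : ∑ i, c i = ∑ i, d i) (h2 : ∑ i, c i • p i = ∑ i, d i • p i) : c = d := by
  by_contra hne
  rcases lexPos_or_lexPos_neg (sub_ne_zero.mpr hne) with h | h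
  · refine hd _ (sub_mem_affineDeps h1 h2) (fun i hi => ?_) h
    simpa [Function.notMem_support.mp hi] using hc0 i
  · refine hc _ (neg_mem (sub_mem_affineDeps h1 h2)) (fun i hi => ?_) h
    simpa [Function.notMem_support.mp hi] using hd0 i

theorem exists_lex_max {K : Set (Fin n → ℝ)} (hK : IsCompact K) (hne : K.Nonempty) :
    ∃ c ∈ K, ∀ d ∈ K, ¬ LexPos (d - c) := by
  -- `K'` collects the points of `K` whose first `m` coordinates are lexicographically maximal; each
  -- step maximises one more coordinate.
  have key : ∀ m : ℕ, m ≤ n → ∃ K' ⊆ K, IsCompact K' ∧ K'.Nonempty ∧ ∀ c ∈ K', ∀ d ∈ K,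
      (∃ i : Fin n, (d - c) i < 0 ∧ ∀ j < i, (d - c) j = 0) ∨
      (d ∈ K' ∧ ∀ i : Fin n, (i : ℕ) < m → (d - c) i = 0) := by
    intro m
    induction m with
    | zero => exact fun _ => ⟨K, subset_rfl, hK, hne, fun c _ d hd => Or.inr ⟨hd, by simp⟩⟩
    | succ m ih =>
      intro hm
      obtain ⟨K', hsub, hcomp, hne', h⟩ := ih (by omega)
      let i0 : Fin n := ⟨m, hm⟩
      obtain ⟨e, he, hmax⟩ := hcomp.exists_isMaxOn hne' (continuous_apply i0).continuousOn
      refine ⟨K' ∩ {c | c i0 = e i0}, Set.inter_subset_left.trans hsub,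
        hcomp.inter_right (isClosed_eq (continuous_apply i0) continuous_const), ⟨e, he, rfl⟩, ?_⟩
      rintro c ⟨hc, hce⟩ d hd
      rcases h c hc d hd with hl | ⟨hdK, hz⟩
      · exact Or.inl hl
      · have hde : d i0 ≤ e i0 := hmax hdK
        rcases hde.eq_or_lt with heq | hlt
        · refine Or.inr ⟨⟨hdK, heq⟩, fun i hi => ?_⟩
          rcases Nat.lt_succ_iff_lt_or_eq.mp hi with h' | h'
          · exact hz i h'
          · obtain rfl : i = i0 := Fin.ext h'
            simp [heq, show c i0 = e i0 from hce]
        · refine Or.inl ⟨i0, ?_, fun j hj => hz j hj⟩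
          simp [show c i0 = e i0 from hce, hlt]
  obtain ⟨K', hsub, -, ⟨c, hc⟩, h⟩ := key n le_rfl
  refine ⟨c, hsub hc, fun d hd ⟨i, hi, hlt⟩ => ?_⟩
  rcases h c hc d hd with ⟨j, hj, hj'⟩ | ⟨-, hz⟩
  · rcases lt_trichotomy i j with hij | rfl | hij
    · exact absurd (hj' i hij) hi.ne'
    · exact absurd hi hj.not_gt
    · exact absurd (hlt j hij) hj.ne
  · exact absurd (hz i i.2) hi.ne'

theorem exists_pos_add_smul_nonneg {c k : Fin n → ℝ} (hc : 0 ≤ c) (hk : ∀ i, c i = 0 → 0 ≤ k i) :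
    ∃ ε : ℝ, 0 < ε ∧ 0 ≤ c + ε • k := by
  have h : ∀ i, ∀ᶠ ε : ℝ in nhdsWithin 0 (Set.Ioi 0), 0 ≤ c i + ε * k i := by
    intro i
    rcases (hc i).eq_or_lt with h0 | h0
    · filter_upwards [self_mem_nhdsWithin] with ε hε
      have := mul_nonneg (le_of_lt hε) (hk i h0.symm)
      rw [← h0]
      simpa using this
    · have ht : Filter.Tendsto (fun ε : ℝ => c i + ε * k i) (nhdsWithin 0 (Set.Ioi 0))
          (nhds (c i + 0 * k i)) :=
        ((continuous_const.add (continuous_id.mul continuous_const)).tendsto 0).mono_left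
          nhdsWithin_le_nhds
      rw [zero_mul, add_zero] at ht
      exact (ht.eventually (eventually_gt_nhds h0)).mono fun _ h => h.le
  obtain ⟨ε, h1, h2⟩ := ((Filter.eventually_all.mpr h).and self_mem_nhdsWithin).exists
  exact ⟨ε, h2, fun i => by simpa using h1 i⟩

/-- `E` carries no topology; scalar equations let closedness of the solution set be checked in
coefficient space. -/
theorem sum_smul_eq_iff_forall_dual {p : Fin n → E} {c d : Fin n → ℝ} :
    ∑ i, c i • p i = ∑ i, d i • p i ↔
      ∀ φ : Module.Dual ℝ E, ∑ i, c i * φ (p i) = ∑ i, d i * φ (p i) := by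
  rw [← sub_eq_zero, ← Module.forall_dual_apply_eq_zero_iff ℝ]
  simp [sub_eq_zero]

theorem exists_isCell_support (p : Fin n → E) {c : Fin n → ℝ} (hc : 0 ≤ c) :
    ∃ d : Fin n → ℝ, 0 ≤ d ∧ IsCell p d.support ∧ ∑ i, d i = ∑ i, c i ∧
      ∑ i, d i • p i = ∑ i, c i • p i := by
  let K : Set (Fin n → ℝ) :=
    {d | 0 ≤ d ∧ ∑ i, d i = ∑ i, c i ∧ ∑ i, d i • p i = ∑ i, c i • p i}
  have hcl : IsClosed K := by
    have h1 : IsClosed {d : Fin n → ℝ | 0 ≤ d} := isClosed_le continuous_const continuous_id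
    have h2 : IsClosed {d : Fin n → ℝ | ∑ i, d i = ∑ i, c i} :=
      isClosed_eq (by fun_prop) continuous_const
    have h3 : IsClosed {d : Fin n → ℝ | ∑ i, d i • p i = ∑ i, c i • p i} := by
      simp only [sum_smul_eq_iff_forall_dual, Set.ofPred_forall]
      exact isClosed_iInter fun φ => isClosed_eq (by fun_prop) continuous_const
    exact h1.inter (h2.inter h3)
  have hcomp : IsCompact K := by
    refine (isCompact_Icc (a := (0 : Fin n → ℝ)) (b := fun _ => ∑ i, c i)).of_isClosed_subset hcl ?_
    rintro d ⟨h0, h1, -⟩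
    refine ⟨h0, fun i => ?_⟩
    rw [← h1]
    exact Finset.single_le_sum (fun j _ => h0 j) (Finset.mem_univ i)
  obtain ⟨d, ⟨h0, h1, h2⟩, hmax⟩ := exists_lex_max hcomp ⟨c, hc, rfl, rfl⟩
  refine ⟨d, h0, fun k hk hk' hlex => ?_, h1, h2⟩
  -- A lexicographically positive `k` would make `d + ε • k` a larger element of `K`.
  obtain ⟨ε, hε, hnn⟩ := exists_pos_add_smul_nonneg h0
    (fun i hi => hk' i (by simpa using hi))
  refine hmax (d + ε • k) ⟨hnn, ?_, ?_⟩ ?_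
  · simp [Finset.sum_add_distrib, ← Finset.mul_sum, hk.1, h1]
  · simp [add_smul, Finset.sum_add_distrib, mul_smul, ← Finset.smul_sum, hk.2, h2]
  · obtain ⟨i, hi, hz⟩ := hlex
    exact ⟨i, by simpa using mul_pos hε hi, fun j hj => by simp [hz j hj]⟩

/-- Combinatorial faces of the convex hull of a point configuration. -/
def IsFace (p : Fin n → E) (G : Finset (Fin n)) : Prop :=
  ∀ k ∈ affineDeps p, (∀ i ∉ G, 0 ≤ k i) → ∀ i ∉ G, k i = 0

theorem isFace_univ (p : Fin n → E) : IsFace p Finset.univ := fun _ _ _ i hi => by simp at hi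

/-- Pairing a dependency with φ - φ(p a) gives a vanishing sum of nonnegative terms, so every term
is zero. -/
theorem IsFace.filter_isMinOn {p : Fin n → E} {G : Finset (Fin n)} (hG : IsFace p G)
    (φ : Module.Dual ℝ E) {a : Fin n} (ha : ∀ i ∈ G, φ (p a) ≤ φ (p i)) :
    IsFace p (G.filter fun i => φ (p i) = φ (p a)) := by
  intro k hk hk' i hi
  have hz : ∀ i ∉ G, k i = 0 := hG k hk fun i hi => hk' i (by simp [hi])
  by_cases hiG : i ∈ G
  swap
  · exact hz i hiG
  have hsum : ∑ i, k i * (φ (p i) - φ (p a)) = 0 := by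
    have := congrArg φ hk.2
    simp only [map_sum, map_smul, smul_eq_mul, map_zero] at this
    simp [mul_sub, Finset.sum_sub_distrib, this, ← Finset.sum_mul, hk.1]
  have hterm : ∀ j ∈ Finset.univ, 0 ≤ k j * (φ (p j) - φ (p a)) := by
    intro j _
    by_cases hj : j ∈ G
    · by_cases hj' : φ (p j) = φ (p a)
      · simp [hj']
      · exact mul_nonneg (hk' j (by simp [hj'])) (sub_nonneg.mpr (ha j hj))
    · simp [hz j hj]
  have := (Finset.sum_eq_zero_iff_of_nonneg hterm).mp hsum i (Finset.mem_univ i)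
  rcases mul_eq_zero.mp this with h | h
  · exact h
  · exact absurd (Finset.mem_filter.mpr ⟨hiG, (sub_eq_zero.mp h : φ (p i) = φ (p a))⟩) hi

theorem mem_convexHull_image_iff {p : Fin n → E} {G : Set (Fin n)} {x : E} :
    x ∈ convexHull ℝ (p '' G) ↔
      ∃ c : Fin n → ℝ, 0 ≤ c ∧ (∀ i ∉ G, c i = 0) ∧ ∑ i, c i = 1 ∧ ∑ i, c i • p i = x := by
  classical
  constructor
  · intro hx
    refine convexHull_min (t := {x | ∃ c : Fin n → ℝ, 0 ≤ c ∧ (∀ i ∉ G, c i = 0) ∧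
      ∑ i, c i = 1 ∧ ∑ i, c i • p i = x}) ?_ ?_ hx
    · rintro _ ⟨i, hi, rfl⟩
      refine ⟨Pi.single i 1, by simp, fun j hj => ?_, by simp, ?_⟩
      · exact Pi.single_eq_of_ne (fun h : j = i => hj (h ▸ hi)) _
      · simp [Pi.single_apply, ite_smul]
    · rintro _ ⟨c, h0, h1, h2, rfl⟩ _ ⟨d, h0', h1', h2', rfl⟩ a b ha hb hab
      refine ⟨a • c + b • d, add_nonneg (smul_nonneg ha h0) (smul_nonneg hb h0'),
        fun i hi => by simp [h1 i hi, h1' i hi], ?_, ?_⟩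
      · simp [Finset.sum_add_distrib, ← Finset.mul_sum, h2, h2', hab]
      · simp [add_smul, Finset.sum_add_distrib, mul_smul, Finset.smul_sum]
  · rintro ⟨c, h0, h1, h2, rfl⟩
    have hs : ∑ i, c i • p i = ∑ i ∈ Finset.univ.filter (· ∈ G), c i • p i := by
      rw [Finset.sum_filter_of_ne]
      intro i _ hi
      by_contra h
      simp [h1 i h] at hi
    rw [hs]
    refine (convex_convexHull ℝ _).sum_mem (fun i _ => h0 i) ?_ fun i hi =>
      subset_convexHull ℝ _ ⟨i, by simpa using hi, rfl⟩
    rw [← h2, Finset.sum_filter_of_ne]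
    intro i _ hi
    by_contra h
    exact hi (h1 i h)

theorem mem_convexHull_range_iff {p : Fin n → E} {x : E} :
    x ∈ convexHull ℝ (Set.range p) ↔
      ∃ c : Fin n → ℝ, 0 ≤ c ∧ ∑ i, c i = 1 ∧ ∑ i, c i • p i = x := by
  rw [← Set.image_univ, mem_convexHull_image_iff]
  simp

theorem IsFace.isExtreme {p : Fin n → E} {G : Finset (Fin n)} (hG : IsFace p G) :
    IsExtreme ℝ (convexHull ℝ (Set.range p)) (convexHull ℝ (p '' (G : Set (Fin n)))) := by
  refine ⟨convexHull_mono (Set.image_subset_range _ _), ?_⟩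
  intro x hx y hy z hz hzxy
  obtain ⟨c, c0, c1, rfl⟩ := mem_convexHull_range_iff.mp hx
  obtain ⟨d, d0, d1, rfl⟩ := mem_convexHull_range_iff.mp hy
  obtain ⟨e, e0, eG, e1, rfl⟩ := mem_convexHull_image_iff.mp hz
  obtain ⟨a, b, ha, hb, hab, h⟩ := hzxy
  have hk : (a • c + b • d) - e ∈ affineDeps p := by
    apply sub_mem_affineDeps
    · simp [Finset.sum_add_distrib, ← Finset.mul_sum, c1, d1, e1, hab]
    · rw [← h]
      simp [add_smul, Finset.sum_add_distrib, mul_smul, Finset.smul_sum]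
  have hz := hG _ hk (fun i hi => by
    have h1 := mul_nonneg ha.le (c0 i)
    have h2 := mul_nonneg hb.le (d0 i)
    have h3 := eG i (by simpa using hi)
    simp only [Pi.sub_apply, Pi.add_apply, Pi.smul_apply, smul_eq_mul, h3]
    linarith)
  refine mem_convexHull_image_iff.mpr ⟨c, c0, fun i hi => ?_, c1, rfl⟩
  have h0 := hz i (by simpa using hi)
  have h1 := mul_nonneg ha.le (c0 i)
  have h2 := mul_nonneg hb.le (d0 i)
  have h3 := eG i (by simpa using hi)
  simp only [Pi.sub_apply, Pi.add_apply, Pi.smul_apply, smul_eq_mul, h3] at h0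
  have : a * c i = 0 := by linarith
  exact (mul_eq_zero.mp this).resolve_left ha.ne'

end PointConfiguration

/-! ### Edges, generic linear forms, and injectivity on cells. -/

section Edges

variable {E : Type*} [AddCommGroup E] [Module ℝ E] {n : ℕ}

/-- A combinatorial face without proper subfaces having two points lies on a segment. -/
theorem IsFace.exists_convexHull_eq_segment {p : Fin n → E} (hp : Function.Injective p)
    {G : Finset (Fin n)} (hG : IsFace p G) (hcard : 1 < G.card)
    (hmin : ∀ G' ⊂ G, IsFace p G' → G'.card ≤ 1) :
    ∃ a ∈ G, ∃ b ∈ G, a ≠ b ∧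
      convexHull ℝ (p '' (G : Set (Fin n))) = segment ℝ (p a) (p b) := by
  obtain ⟨i, hi, j, hj, hij⟩ := Finset.one_lt_card.mp hcard
  obtain ⟨f, hf⟩ : ∃ f : Module.Dual ℝ E, f (p i) ≠ f (p j) := by
    by_contra! h
    refine hij (hp (sub_eq_zero.mp ((Module.forall_dual_apply_eq_zero_iff ℝ _).mp fun f => ?_)))
    simp [h f]
  obtain ⟨v, hv, hvmin⟩ := G.exists_min_image (fun i => f (p i)) ⟨i, hi⟩
  -- The minimisers of `f` form a proper subface, which by minimality of `G` is a single point.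
  have hvG : ∀ w ∈ G, f (p w) = f (p v) → w = v := by
    intro w hw hwv
    have hss : (G.filter fun i => f (p i) = f (p v)) ⊂ G := by
      refine (Finset.filter_subset _ _).ssubset_of_ne fun h => hf ?_
      rw [← h] at hi hj
      rw [(Finset.mem_filter.mp hi).2, (Finset.mem_filter.mp hj).2]
    exact Finset.card_le_one.mp (hmin _ hss (hG.filter_isMinOn f hvmin)) w
      (Finset.mem_filter.mpr ⟨hw, hwv⟩) v (Finset.mem_filter.mpr ⟨hv, rfl⟩)
  have hpos : ∀ w ∈ G, w ≠ v → 0 < f (p w - p v) := by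
    intro w hw hwv
    rw [map_sub, sub_pos]
    exact lt_of_le_of_ne (hvmin w hw) fun h => hwv (hvG w hw h.symm)
  have hne : (G.erase v).Nonempty := by
    rw [← Finset.card_pos, Finset.card_erase_of_mem hv]
    omega
  have hcol : ∀ u ∈ G.erase v, ∀ w ∈ G.erase v,
      f (p w - p v) • (p u - p v) = f (p u - p v) • (p w - p v) := by
    intro u hu w hw
    rw [← sub_eq_zero]
    refine (Module.forall_dual_apply_eq_zero_iff ℝ _).mp fun g => ?_
    -- With ρ the least slope of `g` against `f`, the form `g - ρ • f` is minimal on `G` at both `v`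
    -- and `w0`. That face has two points, hence is all of `G`, so `g` is proportional to `f` on the
    -- differences from `p v`.
    obtain ⟨w0, hw0, hw0min⟩ := (G.erase v).exists_min_image
      (fun w => g (p w - p v) / f (p w - p v)) hne
    set ρ := g (p w0 - p v) / f (p w0 - p v) with hρ
    have hw0' := Finset.mem_erase.mp hw0
    have hge : ∀ i ∈ G, (g - ρ • f) (p v) ≤ (g - ρ • f) (p i) := by
      intro i hi
      rcases eq_or_ne i v with rfl | hiv
      · exact le_rfl
      · have h := hw0min i (Finset.mem_erase.mpr ⟨hiv, hi⟩)
        rw [le_div_iff₀ (hpos i hi hiv)] at h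
        rw [← sub_nonneg, ← map_sub]
        simpa using h
    have hface := hG.filter_isMinOn (g - ρ • f) hge
    have heq : (G.filter fun i => (g - ρ • f) (p i) = (g - ρ • f) (p v)) = G := by
      by_contra hne'
      have h1 := hmin _ ((Finset.filter_subset _ _).ssubset_of_ne hne') hface
      refine hw0'.1 (Finset.card_le_one.mp h1 w0 (Finset.mem_filter.mpr ⟨hw0'.2, ?_⟩) v
        (Finset.mem_filter.mpr ⟨hv, rfl⟩))
      rw [← sub_eq_zero, ← map_sub]
      have := (hpos w0 hw0'.2 hw0'.1).ne'
      simp only [LinearMap.sub_apply, LinearMap.smul_apply, smul_eq_mul, hρ]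
      field_simp
      ring
    have hval : ∀ i ∈ G, g (p i - p v) = ρ * f (p i - p v) := by
      intro i hi
      rw [← heq] at hi
      have := (Finset.mem_filter.mp hi).2
      rw [← sub_eq_zero, ← map_sub] at this
      simpa [sub_eq_zero] using this
    rw [map_sub, map_smul, map_smul, hval u (Finset.mem_of_mem_erase hu),
      hval w (Finset.mem_of_mem_erase hw)]
    simp only [smul_eq_mul]
    ring
  obtain ⟨b, hb, hbmax⟩ := (G.erase v).exists_max_image (fun i => f (p i - p v)) hne
  have hb' := Finset.mem_erase.mp hb
  have hfb := hpos b hb'.2 hb'.1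
  refine ⟨v, hv, b, hb'.2, hb'.1.symm, subset_antisymm (convexHull_min ?_ (convex_segment _ _)) ?_⟩
  · rintro _ ⟨w, hw, rfl⟩
    rcases eq_or_ne w v with rfl | hwv
    · exact left_mem_segment _ _ _
    · rw [segment_eq_image']
      have hw' : w ∈ G.erase v := Finset.mem_erase.mpr ⟨hwv, hw⟩
      refine ⟨f (p w - p v) / f (p b - p v), ⟨div_nonneg (hpos w hw hwv).le hfb.le,
        (div_le_one hfb).mpr (hbmax w hw')⟩, ?_⟩
      have h := hcol w hw' b hb
      have h2 : (f (p w - p v) / f (p b - p v)) • (p b - p v) = p w - p v := by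
        rw [div_eq_inv_mul, mul_smul, ← h, smul_smul, inv_mul_cancel₀ hfb.ne', one_smul]
      simp only [h2, add_sub_cancel]
  · exact segment_subset_convexHull ⟨v, hv, rfl⟩ ⟨b, hb'.2, rfl⟩

theorem IsFace.exists_edge {p : Fin n → E} (hp : Function.Injective p)
    {G : Finset (Fin n)} (hG : IsFace p G) (hcard : 1 < G.card) :
    ∃ a ∈ G, ∃ b ∈ G, a ≠ b ∧
      IsExtreme ℝ (convexHull ℝ (Set.range p)) (segment ℝ (p a) (p b)) := by
  induction G using Finset.strongInduction with
  | H G ih =>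
    by_cases h : ∀ G' ⊂ G, IsFace p G' → G'.card ≤ 1
    · obtain ⟨a, ha, b, hb, hab, heq⟩ := hG.exists_convexHull_eq_segment hp hcard h
      exact ⟨a, ha, b, hb, hab, heq ▸ hG.isExtreme⟩
    · push Not at h
      obtain ⟨G', hss, hG', hc⟩ := h
      obtain ⟨a, ha, b, hb, hab⟩ := ih G' hss hG' hc
      exact ⟨a, hss.1 ha, b, hss.1 hb, hab⟩

/-- The linear form `f` takes different values at the two ends of every edge of the convex hull
of the configuration `p`. -/
def IsGenericOn (p : Fin n → E) (f : Module.Dual ℝ E) : Prop :=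
  ∀ x y : E, x ≠ y → IsExtreme ℝ (convexHull ℝ (Set.range p)) (segment ℝ x y) → f x ≠ f y

/-- Two minimisers would span a face containing an edge on which `f` is constant. -/
theorem IsFace.eq_of_isMinOn {p : Fin n → E} (hp : Function.Injective p)
    {f : Module.Dual ℝ E} (hf : IsGenericOn p f) {G : Finset (Fin n)} (hG : IsFace p G)
    {a b : Fin n} (ha : a ∈ G) (hb : b ∈ G) (hmin : ∀ i ∈ G, f (p a) ≤ f (p i))
    (hab : f (p b) = f (p a)) : b = a := by
  by_contra hne
  have hcard : 1 < (G.filter fun i => f (p i) = f (p a)).card :=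
    Finset.one_lt_card.mpr ⟨b, Finset.mem_filter.mpr ⟨hb, hab⟩, a,
      Finset.mem_filter.mpr ⟨ha, rfl⟩, hne⟩
  obtain ⟨c, hc, d, hd, hcd, hext⟩ := (hG.filter_isMinOn f hmin).exists_edge hp hcard
  refine hf _ _ (hp.ne hcd) hext ?_
  rw [(Finset.mem_filter.mp hc).2, (Finset.mem_filter.mp hd).2]

/-- Every set of indices spans a combinatorial face, all of whose points occur with a positive
coefficient in a single dependency. -/
theorem exists_isFace_of_subset (p : Fin n → E) (B : Finset (Fin n)) :
    ∃ k ∈ affineDeps p, (∀ i ∉ B, 0 ≤ k i) ∧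
      IsFace p (B ∪ Finset.univ.filter fun i => 0 < k i) := by
  classical
  obtain ⟨F, hF, hmax⟩ := (Set.toFinite {F : Finset (Fin n) | ∃ k ∈ affineDeps p,
    (∀ i ∉ B, 0 ≤ k i) ∧ F = B ∪ Finset.univ.filter fun i => 0 < k i}).exists_maximal
      ⟨_, 0, zero_mem _, by simp, rfl⟩
  obtain ⟨k, hk, hkB, rfl⟩ := hF
  refine ⟨k, hk, hkB, fun l hl hlF i hi => ?_⟩
  have hkpos : ∀ j ∉ B, 0 ≤ l j ∨ 0 < k j := by
    intro j hj
    by_cases h : 0 < k j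
    · exact Or.inr h
    · exact Or.inl (hlF j (by simp [hj, h]))
  obtain ⟨ε, hε, hnn⟩ := exists_pos_add_smul_nonneg (n := n)
    (c := fun j => if j ∈ B then 0 else k j) (k := fun j => if j ∈ B then 0 else l j)
    (fun j => by by_cases h : j ∈ B <;> simp [h, hkB])
    (fun j hj => by
      by_cases h : j ∈ B
      · simp [h]
      · simp only [h, if_false] at hj ⊢
        exact (hkpos j h).resolve_right (by simp [hj]))
  have hnn' : ∀ j ∉ B, 0 ≤ k j + ε * l j := fun j hj => by simpa [hj] using hnn j
  -- One copy of `k` offsets the negative entries of `ε • l` off `B`; the other keeps the old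
  -- positive entries positive. A new positive entry at `i` then contradicts maximality.
  have hmem : k + (k + ε • l) ∈ affineDeps p :=
    add_mem hk (add_mem hk ((affineDeps p).smul_mem ε hl))
  have hle := hmax ⟨_, hmem, fun j hj => by
      simpa using add_nonneg (hkB j hj) (hnn' j hj), rfl⟩ (by
    intro j hj
    by_cases hjB : j ∈ B
    · simp [hjB]
    · have hkj : 0 < k j := by simpa [hjB] using hj
      have := hnn' j hjB
      simp only [Finset.mem_union, hjB, false_or, Finset.mem_filter, Finset.mem_univ, true_and]
      simpa using add_pos_of_pos_of_nonneg hkj this)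
  by_contra hli
  have hiB : i ∉ B := fun h => hi (by simp [h])
  have hlpos : 0 < l i := lt_of_le_of_ne (hlF i hi) (Ne.symm hli)
  refine hi (hle ?_)
  simp only [Finset.mem_union, hiB, false_or, Finset.mem_filter, Finset.mem_univ, true_and]
  have h1 := hkB i hiB
  have h2 := mul_pos hε hlpos
  simp only [Pi.add_apply, Pi.smul_apply, smul_eq_mul]
  linarith

/-- A generic linear form is injective on the cells of a pulling triangulation whose pulling order
refines the order of its values. -/
theorem IsCell.injOn {p : Fin n → E} (hp : Function.Injective p) {f : Module.Dual ℝ E}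
    (hf : IsGenericOn p f) (hmono : Monotone fun i => f (p i)) {B : Set (Fin n)}
    (hB : IsCell p B) : Set.InjOn (fun i => f (p i)) B := by
  classical
  have key : ∀ i ∈ B, ∀ j ∈ B, i < j → f (p i) ≠ f (p j) := by
    intro i hi j hj hij hfij
    -- With the vertices before `i` discarded, a dependency nonnegative off `B'` is
    -- lexicographically positive as soon as it has a positive entry before `i`.
    set B' : Finset (Fin n) := Finset.univ.filter fun b => b ∈ B ∧ i ≤ b with hB'
    have hcell : IsCell p (B' : Set (Fin n)) := hB.mono fun b hb => by
      simp only [hB', Finset.coe_filter, Finset.mem_univ, true_and] at hb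
      exact hb.1
    obtain ⟨k, hk, hkB, hface⟩ := exists_isFace_of_subset p B'
    set F := B' ∪ Finset.univ.filter fun i => 0 < k i
    have hiF : i ∈ F := Finset.mem_union_left _ (by simp [hB', hi])
    have hjF : j ∈ F := Finset.mem_union_left _ (by simp [hB', hj, hij.le])
    obtain ⟨u, hu, humin⟩ := F.exists_min_image (fun i => f (p i)) ⟨i, hiF⟩
    -- Otherwise both `i` and `j` would be the unique minimiser. So `u` precedes `i`, and it can lie
    -- in `F` only through a positive entry of `k`.
    have hui : f (p u) < f (p i) := by
      refine lt_of_le_of_ne (humin i hiF) fun h => hij.ne ?_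
      rw [hface.eq_of_isMinOn hp hf hu hiF humin h.symm,
        hface.eq_of_isMinOn hp hf hu hjF humin (hfij.symm.trans h.symm)]
    have hlt : u < i := lt_of_not_ge fun h => (hmono h).not_gt hui
    have hnot : ∀ a < i, a ∉ B' := fun a ha h => by
      simp only [hB', Finset.mem_filter, Finset.mem_univ, true_and] at h
      exact absurd h.2 (not_le.mpr ha)
    have hku : 0 < k u := by
      simpa using (Finset.mem_union.mp hu).resolve_left (hnot u hlt)
    obtain ⟨w, hw, hwmin⟩ := Finset.exists_minimal
      (s := Finset.univ.filter fun a => 0 < k a) ⟨u, by simpa using hku⟩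
    have hwpos : 0 < k w := by simpa using hw
    have hwle : w ≤ u := by
      by_contra h
      exact h (hwmin (by simpa using hku) (not_le.mp h).le)
    refine hcell k hk (fun a ha => hkB a ha) ⟨w, hwpos, fun a ha => ?_⟩
    have h0 := hkB a (hnot a (ha.trans_le (hwle.trans hlt.le)))
    refine le_antisymm (not_lt.mp fun h => ?_) h0
    exact absurd (hwmin (by simpa using h) ha.le) (not_le.mpr ha)
  intro i hi j hj hij
  rcases lt_trichotomy i j with h | h | h
  · exact absurd hij (key i hi j hj h)
  · exact h
  · exact absurd hij.symm (key j hj i hi h)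

/-- Positivity at this one vertex, where the form is least, bounds the form below by 0 at all the
points. -/
theorem apply_zero_mem_extremePoints {p : Fin (n + 1) → E} (hp : Function.Injective p)
    {f : Module.Dual ℝ E} (hf : IsGenericOn p f) (hmono : Monotone fun i => f (p i)) :
    p 0 ∈ Set.extremePoints ℝ (convexHull ℝ (Set.range p)) := by
  have hmin : ∀ i ∈ Finset.univ, f (p 0) ≤ f (p i) := fun i _ => hmono (Fin.zero_le i)
  have hface := (isFace_univ p).filter_isMinOn f hmin
  have heq : (Finset.univ.filter fun i => f (p i) = f (p 0)) = {0} := by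
    ext i
    simp only [Finset.mem_filter, Finset.mem_univ, true_and, Finset.mem_singleton]
    exact ⟨fun h => (isFace_univ p).eq_of_isMinOn hp hf (Finset.mem_univ _) (Finset.mem_univ _)
      hmin h, fun h => h ▸ rfl⟩
  rw [heq] at hface
  have := hface.isExtreme
  rwa [Finset.coe_singleton, Set.image_singleton, convexHull_singleton,
    isExtreme_singleton] at this

end Edges

/-! ### Complete homogeneous sums as combinations of powers. -/

section CompleteHomogeneous

open Lagrange

variable {K : Type*} [Field K] {ι : Type*} [DecidableEq ι]

/-- The complete homogeneous symmetric polynomial of degree `N` in the values `y i`, `i ∈ T`. -/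
def completeHomog (T : Finset ι) (y : ι → K) (N : ℕ) : K :=
  ∑ k ∈ T.piAntidiag N, ∏ i ∈ T, y i ^ k i

theorem completeHomog_zero (T : Finset ι) (y : ι → K) : completeHomog T y 0 = 1 := by
  simp [completeHomog]

theorem completeHomog_singleton (t : ι) (y : ι → K) (N : ℕ) :
    completeHomog {t} y N = y t ^ N := by
  rw [completeHomog, Finset.sum_eq_single_of_mem (Pi.single t N)]
  · simp
  · simp only [Finset.mem_piAntidiag, Finset.sum_singleton, Pi.single_eq_same, true_and,
      Finset.mem_singleton]
    exact fun i hi => by_contra fun h => hi (Pi.single_eq_of_ne h _)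
  · intro k hk hne
    refine absurd ?_ hne
    simp only [Finset.mem_piAntidiag, Finset.sum_singleton, Finset.mem_singleton] at hk
    ext i
    rcases eq_or_ne i t with rfl | h
    · simp [hk.1]
    · rw [Pi.single_eq_of_ne h]
      exact by_contra fun h' => h (hk.2 i h')

theorem completeHomog_insert {T : Finset ι} {t : ι} (ht : t ∉ T) (y : ι → K) (N : ℕ) :
    completeHomog (insert t T) y N =
      ∑ ab ∈ Finset.HasAntidiagonal.antidiagonal N, y t ^ ab.1 * completeHomog T y ab.2 := by
  rw [completeHomog, ← Finset.cons_eq_insert t T ht, Finset.piAntidiag_cons, Finset.sum_disjiUnion]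
  refine Finset.sum_congr rfl fun ab _ => ?_
  rw [Finset.sum_map, completeHomog, Finset.mul_sum]
  refine Finset.sum_congr rfl fun k hk => ?_
  rw [Finset.prod_cons]
  have hkt : k t = 0 := by
    by_contra h
    exact ht ((Finset.mem_piAntidiag.mp hk).2 t h)
  congr 1
  · simp [hkt]
  · refine Finset.prod_congr rfl fun i hi => ?_
    have : i ≠ t := fun h => ht (h ▸ hi)
    simp [this]

theorem completeHomog_insert_succ {T : Finset ι} {t : ι} (ht : t ∉ T) (y : ι → K) (N : ℕ) :
    completeHomog (insert t T) y (N + 1) =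
      y t * completeHomog (insert t T) y N + completeHomog T y (N + 1) := by
  rw [completeHomog_insert ht, Finset.Nat.sum_antidiagonal_succ, completeHomog_insert ht,
    Finset.mul_sum, pow_zero, one_mul, add_comm]
  congr 1
  refine Finset.sum_congr rfl fun ab _ => ?_
  ring

/-- This is the coefficient of degree `T.card - 1` in the Lagrange interpolation of X^e. -/
theorem sum_pow_mul_nodalWeight {T : Finset ι} {y : ι → K} (hy : Set.InjOn y T) {e : ℕ}
    (he : e < T.card) :
    ∑ i ∈ T, y i ^ e * nodalWeight T y i = if e + 1 = T.card then 1 else 0 := by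
  have h := coeff_eq_sum hy (P := (Polynomial.X ^ e : Polynomial K))
    (by rw [Polynomial.degree_X_pow]; exact_mod_cast he)
  rw [Polynomial.coeff_X_pow] at h
  have : (T.card - 1 = e) ↔ (e + 1 = T.card) := by omega
  simp only [this] at h
  rw [h]
  refine Finset.sum_congr rfl fun i _ => ?_
  simp [nodalWeight, div_eq_mul_inv, Finset.prod_inv_distrib]

theorem sum_pow_mul_nodalWeight_insert {T : Finset ι} {t : ι} (ht : t ∉ T) {y : ι → K}
    (hy : Set.InjOn y (insert t T : Finset ι)) (e : ℕ) :
    ∑ i ∈ insert t T, y i ^ (e + 1) * nodalWeight (insert t T) y i =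
      y t * ∑ i ∈ insert t T, y i ^ e * nodalWeight (insert t T) y i +
        ∑ i ∈ T, y i ^ e * nodalWeight T y i := by
  rw [← sub_eq_iff_eq_add', Finset.mul_sum, ← Finset.sum_sub_distrib, Finset.sum_insert ht]
  rw [show y t ^ (e + 1) * nodalWeight (insert t T) y t -
    y t * (y t ^ e * nodalWeight (insert t T) y t) = 0 by ring, zero_add]
  refine Finset.sum_congr rfl fun i hi => ?_
  have hit : i ≠ t := fun h => ht (h ▸ hi)
  have hne : y i - y t ≠ 0 := sub_ne_zero.mpr fun h =>
    hit (hy (by simp [hi]) (by simp) h)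
  have hw : nodalWeight (insert t T) y i = (y i - y t)⁻¹ * nodalWeight T y i := by
    rw [nodalWeight, Finset.erase_insert_of_ne hit.symm, Finset.prod_insert, nodalWeight]
    exact fun h => ht (Finset.mem_of_mem_erase h)
  rw [hw]
  field_simp
  ring

/-- Both sides satisfy h_{N+1}(T ∪ {t}) = y_t h_N(T ∪ {t}) + h_{N+1}(T) and agree at N = 0. -/
theorem completeHomog_eq_sum {T : Finset ι} (hT : T.Nonempty) {y : ι → K} (hy : Set.InjOn y T)
    (N : ℕ) :
    completeHomog T y N = ∑ i ∈ T, y i ^ (N + (T.card - 1)) * nodalWeight T y i := by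
  induction hT using Finset.Nonempty.cons_induction generalizing N with
  | singleton t => simp [completeHomog_singleton, nodalWeight]
  | cons t T ht hT ih =>
    rw [Finset.cons_eq_insert] at hy ⊢
    have hcard : (insert t T).card - 1 = T.card := by simp [ht]
    rw [hcard]
    induction N with
    | zero =>
      rw [completeHomog_zero, zero_add, sum_pow_mul_nodalWeight hy (by simp [ht])]
      simp [ht]
    | succ N ihN =>
      rw [completeHomog_insert_succ ht, ihN, ih (hy.mono (by simp)),
        show N + 1 + T.card = N + T.card + 1 by ring, sum_pow_mul_nodalWeight_insert ht hy]
      have := hT.card_pos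
      rw [show N + 1 + (T.card - 1) = N + T.card by omega]

end CompleteHomogeneous

/-! ### The lattice inside its real span, and dilates in coordinates. -/

theorem realForm_latticeEmb {M : Type*} [AddCommGroup M] (lam : Module.Dual ℤ M) (v : M) :
    realForm lam (latticeEmb M v) = lam v := by
  change Module.Dual.baseChange ℝ lam ((1 : ℝ) ⊗ₜ[ℤ] v) = _
  rw [Module.Dual.baseChange_apply_tmul]
  simp

theorem latticeEmb_injective {M : Type*} [AddCommGroup M] [Module.Free ℤ M] :
    Function.Injective (latticeEmb M) := by
  rw [injective_iff_map_eq_zero]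
  intro v hv
  let b := Module.Free.chooseBasis ℤ M
  refine b.repr.map_eq_zero_iff.mp (Finsupp.ext fun i => ?_)
  have := realForm_latticeEmb (b.coord i) v
  rw [hv, map_zero] at this
  exact_mod_cast this.symm

theorem mem_nat_smul_convexHull_range_iff {E : Type*} [AddCommGroup E] [Module ℝ E] {r : ℕ}
    {p : Fin (r + 1) → E} {n : ℕ} {x : E} :
    x ∈ (n : ℝ) • convexHull ℝ (Set.range p) ↔
      ∃ c : Fin (r + 1) → ℝ, 0 ≤ c ∧ ∑ i, c i = n ∧ ∑ i, c i • p i = x := by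
  constructor
  · rintro ⟨y, hy, rfl⟩
    obtain ⟨c, h0, h1, rfl⟩ := mem_convexHull_range_iff.mp hy
    exact ⟨(n : ℝ) • c, smul_nonneg n.cast_nonneg h0, by simp [← Finset.mul_sum, h1],
      by simp [mul_smul, Finset.smul_sum]⟩
  · rintro ⟨c, h0, h1, rfl⟩
    rcases Nat.eq_zero_or_pos n with rfl | hn
    · have hc : ∀ i, c i = 0 := fun i =>
        (Finset.sum_eq_zero_iff_of_nonneg fun i _ => h0 i).mp (by simpa using h1) i
          (Finset.mem_univ i)
      exact ⟨p 0, subset_convexHull ℝ _ ⟨0, rfl⟩, by simp [hc]⟩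
    · have hn' : (n : ℝ) ≠ 0 := by positivity
      refine ⟨∑ i, ((n : ℝ)⁻¹ • c) i • p i, mem_convexHull_range_iff.mpr
        ⟨(n : ℝ)⁻¹ • c, smul_nonneg (by positivity) h0, ?_, rfl⟩, ?_⟩
      · simp [← Finset.mul_sum, h1, hn']
      · change (n : ℝ) • ∑ i, _ = _
        rw [Finset.smul_sum]
        refine Finset.sum_congr rfl fun i _ => ?_
        rw [smul_smul, Pi.smul_apply, smul_eq_mul, mul_inv_cancel_left₀ hn']

/-! ### Box points and the half-open decomposition of the dilates. -/

section Counting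

variable {M : Type*} [AddCommGroup M] {r : ℕ}

/-- A fundamental coefficient vector of a half-open cell of the pulling triangulation, together
with its height and the lattice point it represents. -/
def IsBoxPoint (s : Fin (r + 1) → M) (b : (Fin (r + 1) → ℝ) × ℕ × M) : Prop :=
  0 ≤ b.1 ∧ b.1 0 < 1 ∧ (∀ i, b.1 i ≤ 1) ∧ IsCell (latticeEmb M ∘ s) b.1.support ∧
    ∑ i, b.1 i = b.2.1 ∧ ∑ i, b.1 i • latticeEmb M (s i) = latticeEmb M b.2.2

/-- The vertices of the half-open cell of a coefficient vector. -/
def cellVertices (a : Fin (r + 1) → ℝ) : Finset (Fin (r + 1)) :=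
  insert 0 (Finset.univ.filter fun i => a i ≠ 0)

theorem coe_cellVertices (a : Fin (r + 1) → ℝ) :
    (cellVertices a : Set (Fin (r + 1))) = insert 0 a.support := by
  ext i; simp [cellVertices]

theorem zero_mem_cellVertices (a : Fin (r + 1) → ℝ) : 0 ∈ cellVertices a := by
  simp [cellVertices]

theorem eq_zero_of_notMem_cellVertices {a : Fin (r + 1) → ℝ} {i : Fin (r + 1)}
    (hi : i ∉ cellVertices a) : a i = 0 := by
  by_contra h
  exact hi (by simp [cellVertices, h])

theorem IsBoxPoint.isCell {s : Fin (r + 1) → M} {b : (Fin (r + 1) → ℝ) × ℕ × M}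
    (hb : IsBoxPoint s b) : IsCell (latticeEmb M ∘ s) (cellVertices b.1 : Set (Fin (r + 1))) := by
  rw [coe_cellVertices]
  exact hb.2.2.2.1.insert_zero

theorem IsBoxPoint.sum_cellVertices {s : Fin (r + 1) → M} {b : (Fin (r + 1) → ℝ) × ℕ × M}
    (hb : IsBoxPoint s b) : ∑ i ∈ cellVertices b.1, b.1 i = b.2.1 := by
  rw [← hb.2.2.2.2.1]
  exact Finset.sum_subset (Finset.subset_univ _)
    fun i _ hi => eq_zero_of_notMem_cellVertices hi

/-- Strictness comes from the coordinate at 0. It makes the natural subtraction `card - 1 - height`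
exact. -/
theorem IsBoxPoint.height_lt {s : Fin (r + 1) → M} {b : (Fin (r + 1) → ℝ) × ℕ × M}
    (hb : IsBoxPoint s b) : b.2.1 < (cellVertices b.1).card := by
  have h : ∑ i ∈ cellVertices b.1, b.1 i < ∑ i ∈ cellVertices b.1, (1 : ℝ) :=
    Finset.sum_lt_sum (fun i _ => hb.2.2.1 i) ⟨0, zero_mem_cellVertices _, hb.2.1⟩
  rw [hb.sum_cellVertices] at h
  simpa using h

theorem isLatticePolytope_convexHull_range (s : Fin (r + 1) → M) :
    IsLatticePolytope (convexHull ℝ (Set.range (latticeEmb M ∘ s))) := by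
  classical
  refine ⟨Finset.univ.image s, Finset.univ_nonempty.image s, ?_⟩
  rw [Finset.coe_image, Finset.coe_univ, Set.image_univ, Set.range_comp]

theorem finite_isBoxPoint [Module.Free ℤ M] [Module.Finite ℤ M] (s : Fin (r + 1) → M) :
    {b | IsBoxPoint s b}.Finite := by
  have hfin : (⋃ h ∈ Finset.range (r + 2), ({h} : Set ℕ) ×ˢ
      latticePoints ((h : ℝ) • convexHull ℝ (Set.range (latticeEmb M ∘ s)))).Finite :=
    (Finset.finite_toSet _).biUnion fun h _ => (Set.finite_singleton h).prod
      (finite_latticePoints_smul (isLatticePolytope_convexHull_range s) h)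
  -- Height and lattice point determine the coefficients, by `IsCell.unique`.
  refine Set.Finite.of_finite_image (f := Prod.snd) (hfin.subset ?_) ?_
  · rintro _ ⟨⟨a, h, v⟩, hb, rfl⟩
    have hlt := hb.height_lt.trans_le (Finset.card_le_univ _)
    simp only [Fintype.card_fin] at hlt
    refine Set.mem_biUnion (x := h) (by simpa using hlt.trans (by omega)) ⟨rfl, ?_⟩
    exact mem_nat_smul_convexHull_range_iff.mpr ⟨a, hb.1, hb.2.2.2.2.1, hb.2.2.2.2.2⟩
  · rintro ⟨a, x⟩ hb ⟨a', x'⟩ hb' (rfl : x = x')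
    obtain rfl : a = a' := IsCell.unique hb.1 hb'.1 hb.2.2.2.1 hb'.2.2.2.1 (hb.2.2.2.2.1.trans hb'.2.2.2.2.1.symm)
      (hb.2.2.2.2.2.trans hb'.2.2.2.2.2.symm)
    rfl

/-- The fractional part lies in [0,1) at 0. Elsewhere it lies in (0,1], or it vanishes together with
the integer part. So the two integer parts differ by less than 1. -/
theorem IsBoxPoint.add_eq [Module.Free ℤ M] {s : Fin (r + 1) → M} {b b' : (Fin (r + 1) → ℝ) × ℕ × M}
    (hb : IsBoxPoint s b) (hb' : IsBoxPoint s b') {k k' : Fin (r + 1) → ℕ}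
    (hk : ∀ i, k i ≠ 0 → i ∈ cellVertices b.1) (hk' : ∀ i, k' i ≠ 0 → i ∈ cellVertices b'.1)
    (h : ∀ i, b.1 i + k i = b'.1 i + k' i) : b = b' ∧ k = k' := by
  have hkk : k = k' := by
    ext i
    have hi := h i
    have h0 : 0 ≤ b.1 i := hb.1 i
    have h0' : 0 ≤ b'.1 i := hb'.1 i
    have hlt : |b.1 i - b'.1 i| < 1 := by
      have h1 := hb.2.2.1 i
      have h1' := hb'.2.2.1 i
      rcases eq_or_ne i 0 with rfl | hi0
      · have := hb.2.1
        have := hb'.2.1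
        rw [abs_lt]; constructor <;> linarith
      · by_cases hz : b.1 i = 0
        · have hk0 : k i = 0 := by
            by_contra hne
            exact absurd hz (by simpa [cellVertices, hi0] using hk i hne)
          rw [hz, hk0] at hi
          have : b'.1 i = 0 := by
            have : (0 : ℝ) ≤ k' i := Nat.cast_nonneg _
            push_cast at hi
            linarith
          simp [hz, this]
        · by_cases hz' : b'.1 i = 0
          · have hk0 : k' i = 0 := by
              by_contra hne
              exact absurd hz' (by simpa [cellVertices, hi0] using hk' i hne)
            rw [hz', hk0] at hi
            have : (0 : ℝ) ≤ k i := Nat.cast_nonneg _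
            push_cast at hi
            exact absurd (by linarith) hz
          · have := lt_of_le_of_ne h0 (Ne.symm hz)
            have := lt_of_le_of_ne h0' (Ne.symm hz')
            rw [abs_lt]; constructor <;> linarith
    have h2 : |((k' i : ℤ) - (k i : ℤ) : ℤ)| < 1 := by
      have : (((k' i : ℤ) - (k i : ℤ) : ℤ) : ℝ) = b.1 i - b'.1 i := by push_cast; linarith
      rw [← this] at hlt
      exact_mod_cast hlt
    rw [Int.abs_lt_one_iff] at h2
    omega
  subst hkk
  refine ⟨?_, rfl⟩
  obtain ⟨a, x, v⟩ := b
  obtain ⟨a', x', v'⟩ := b'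
  obtain rfl : a = a' := funext fun i => by simpa using h i
  obtain rfl : x = x' := by
    have := hb.2.2.2.2.1.symm.trans hb'.2.2.2.2.1
    exact_mod_cast this
  obtain rfl : v = v' := latticeEmb_injective (hb.2.2.2.2.2.symm.trans hb'.2.2.2.2.2)
  rfl

/-- The lattice points of a dilate, weighted by an integral linear form, sorted by the half-open
cells of the pulling triangulation. -/
theorem weightedSum_eq_sum_box [Module.Free ℤ M] [Module.Finite ℤ M] (s : Fin (r + 1) → M)
    (lam : Module.Dual ℤ M) (n : ℕ) :
    weightedSum lam ((n : ℝ) • convexHull ℝ (Set.range (latticeEmb M ∘ s))) =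
      ∑ b ∈ (finite_isBoxPoint s).toFinset.filter (fun b => b.2.1 ≤ n),
        (RatFunc.X : RatFunc ℚ) ^ lam b.2.2 *
          completeHomog (cellVertices b.1) (fun i => (RatFunc.X : RatFunc ℚ) ^ lam (s i))
            (n - b.2.1) := by
  have hfin := finite_latticePoints_smul (isLatticePolytope_convexHull_range s) n
  rw [weightedSum, finsum_mem_eq_finite_toFinset_sum _ hfin]
  simp only [completeHomog, Finset.mul_sum]
  rw [Finset.sum_sigma']
  symm
  have hsum : ∀ (a : Fin (r + 1) → ℝ) (N : ℕ) (k : Fin (r + 1) → ℕ),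
      k ∈ (cellVertices a).piAntidiag N → ∑ i, k i = N := by
    intro a N k hk
    rw [Finset.mem_piAntidiag] at hk
    rw [← hk.1]
    exact (Finset.sum_subset (Finset.subset_univ _) fun i _ hi =>
      by_contra fun h => hi (hk.2 i h)).symm
  refine Finset.sum_nbij (fun x => x.1.2.2 + ∑ i, x.2 i • s i) ?_ ?_ ?_ ?_
  · rintro ⟨b, k⟩ hx
    simp only [Finset.mem_sigma, Finset.mem_filter, Set.Finite.mem_toFinset] at hx
    obtain ⟨⟨hb, hn⟩, hk⟩ := hx
    rw [Set.Finite.mem_toFinset]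
    refine mem_nat_smul_convexHull_range_iff.mpr ⟨fun i => b.1 i + k i,
      fun i => add_nonneg (hb.1 i) (Nat.cast_nonneg _), ?_, ?_⟩
    · rw [Finset.sum_add_distrib, hb.2.2.2.2.1, ← Nat.cast_sum, hsum _ _ k hk, Nat.cast_sub hn]
      ring
    · simp only [add_smul, Finset.sum_add_distrib, map_add, map_sum, Function.comp_apply,
        hb.2.2.2.2.2, map_nsmul, Nat.cast_smul_eq_nsmul]
  · rintro ⟨b, k⟩ hx ⟨b', k'⟩ hx' heq
    simp only [Finset.coe_sigma, Set.mem_sigma_iff, Finset.mem_coe, Finset.mem_filter,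
      Set.Finite.mem_toFinset] at hx hx'
    obtain ⟨⟨hb, hn⟩, hk⟩ := hx
    obtain ⟨⟨hb', hn'⟩, hk'⟩ := hx'
    have hsub : ∀ {b : (Fin (r + 1) → ℝ) × ℕ × M} {k : Fin (r + 1) → ℕ},
        IsBoxPoint s b → k ∈ (cellVertices b.1).piAntidiag (n - b.2.1) →
        IsCell (latticeEmb M ∘ s) (fun i => b.1 i + k i : Fin (r + 1) → ℝ).support := by
      intro b k hb hk
      refine hb.isCell.mono fun i hi => ?_
      by_contra hnot
      refine hi ?_
      have hk0 : k i = 0 := by_contra fun h => hnot ((Finset.mem_piAntidiag.mp hk).2 i h)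
      have ha0 : b.1 i = 0 := eq_zero_of_notMem_cellVertices hnot
      simp [hk0, ha0]
    have hc := IsCell.unique (p := latticeEmb M ∘ s) (c := fun i => b.1 i + k i)
      (d := fun i => b'.1 i + k' i) (fun i => add_nonneg (hb.1 i) (Nat.cast_nonneg _))
      (fun i => add_nonneg (hb'.1 i) (Nat.cast_nonneg _)) (hsub hb hk) (hsub hb' hk')
      (by
        rw [Finset.sum_add_distrib, hb.2.2.2.2.1, ← Nat.cast_sum, hsum _ _ k hk, Nat.cast_sub hn,
          Finset.sum_add_distrib, hb'.2.2.2.2.1, ← Nat.cast_sum, hsum _ _ k' hk',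
          Nat.cast_sub hn']
        ring)
      (by
        have := congrArg (latticeEmb M) heq
        simpa only [add_smul, Finset.sum_add_distrib, map_add, map_sum, Function.comp_apply,
          hb.2.2.2.2.2, hb'.2.2.2.2.2, map_nsmul, Nat.cast_smul_eq_nsmul] using this)
    obtain ⟨rfl, rfl⟩ := hb.add_eq hb' (Finset.mem_piAntidiag.mp hk).2
      (Finset.mem_piAntidiag.mp hk').2 (fun i => congrFun hc i)
    rfl
  · intro v hv
    rw [Finset.mem_coe, Set.Finite.mem_toFinset] at hv
    obtain ⟨c', hc', hc1', hc2'⟩ := mem_nat_smul_convexHull_range_iff.mp hv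
    obtain ⟨c, hc0, hcell, hc1, hc2⟩ := exists_isCell_support (latticeEmb M ∘ s) hc'
    rw [hc1'] at hc1
    rw [hc2'] at hc2
    -- Floor at 0 leaves a remainder in [0,1); ceiling minus one leaves a remainder in (0,1] at the
    -- other positive coordinates. Truncated subtraction gives 0 where `c i = 0`.
    let k : Fin (r + 1) → ℕ := fun i => if i = 0 then ⌊c i⌋₊ else ⌈c i⌉₊ - 1
    let a : Fin (r + 1) → ℝ := fun i => c i - k i
    have hk0 : ∀ i ≠ 0, c i = 0 → k i = 0 := fun i hi h => by simp [k, hi, h]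
    have hceil : ∀ i ≠ 0, c i ≠ 0 → (k i : ℝ) = ⌈c i⌉₊ - 1 := fun i hi h => by
      have : 1 ≤ ⌈c i⌉₊ := Nat.one_le_iff_ne_zero.mpr
        (Nat.ceil_pos.mpr (lt_of_le_of_ne (hc0 i) h.symm)).ne'
      simp [k, hi, Nat.cast_sub this]
    have hazero : ∀ i, c i = 0 → a i = 0 := fun i h => by
      rcases eq_or_ne i 0 with rfl | hi
      · simp [a, k, h]
      · simp [a, hk0 i hi h, h]
    have hapos : ∀ i ≠ 0, c i ≠ 0 → 0 < a i := fun i hi h => by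
      have := Nat.ceil_lt_add_one (hc0 i)
      simp only [a, hceil i hi h]
      linarith
    have ha0 : 0 ≤ a := by
      intro i
      rcases eq_or_ne i 0 with rfl | hi
      · simpa [a, k] using Nat.floor_le (hc0 0)
      · by_cases h : c i = 0
        · exact (hazero i h).ge
        · exact (hapos i hi h).le
    have hfloor : a 0 < 1 := by
      have := Nat.lt_floor_add_one (c 0)
      simp only [a, k, if_true]
      linarith
    have ha1 : ∀ i, a i ≤ 1 := by
      intro i
      rcases eq_or_ne i 0 with rfl | hi
      · exact hfloor.le
      · by_cases h : c i = 0
        · simp [hazero i h]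
        · have := Nat.le_ceil (c i)
          simp only [a, hceil i hi h]
          linarith
    have hsuma : ∑ i, a i = n - (∑ i, k i : ℕ) := by simp [a, hc1]
    have hkn : ∑ i, k i ≤ n := by
      have : 0 ≤ ∑ i, a i := Finset.sum_nonneg fun i _ => ha0 i
      rw [hsuma, sub_nonneg] at this
      exact_mod_cast this
    have hkT : ∀ i, k i ≠ 0 → i ∈ cellVertices a := by
      intro i hi
      rcases eq_or_ne i 0 with rfl | hi0
      · exact zero_mem_cellVertices a
      · have := (hapos i hi0 fun h => hi (hk0 i hi0 h)).ne'
        simp [cellVertices, this]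
    refine ⟨⟨(a, n - ∑ i, k i, v - ∑ i, k i • s i), k⟩, ?_, by simp⟩
    simp only [Finset.coe_sigma, Set.mem_sigma_iff, Finset.mem_coe, Finset.mem_filter,
      Set.Finite.mem_toFinset, Finset.mem_piAntidiag]
    refine ⟨⟨⟨ha0, hfloor, ha1, hcell.mono fun i hi h => hi (hazero i h), ?_, ?_⟩,
      Nat.sub_le _ _⟩, ?_, hkT⟩
    · rw [hsuma, Nat.cast_sub hkn]
    · simp only [Function.comp_apply] at hc2
      simp only [a, sub_smul, Finset.sum_sub_distrib, map_sub, map_sum, hc2, map_nsmul,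
        Nat.cast_smul_eq_nsmul]
    · rw [Nat.sub_sub_self hkn]
      exact Finset.sum_subset (Finset.subset_univ _) fun i _ hi => by_contra fun h => hi (hkT i h)
  · rintro ⟨b, k⟩ hx
    simp only [Finset.mem_sigma, Finset.mem_filter, Set.Finite.mem_toFinset] at hx
    have hsub : ∑ i, k i • s i = ∑ i ∈ cellVertices b.1, k i • s i :=
      (Finset.sum_subset (Finset.subset_univ _) fun i _ hi => by
        have : k i = 0 := by_contra fun h => hi ((Finset.mem_piAntidiag.mp hx.2).2 i h)
        simp [this]).symm
    rw [hsub, map_add, zpow_add₀ RatFunc.X_ne_zero, map_sum]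
    congr 1
    induction cellVertices b.1 using Finset.induction_on with
    | empty => simp
    | insert i t hi ih =>
      rw [Finset.prod_insert hi, Finset.sum_insert hi, zpow_add₀ RatFunc.X_ne_zero, ih, map_nsmul,
        nsmul_eq_mul, mul_comm (k i : ℤ), zpow_mul, zpow_natCast]

end Counting

/-! ### Control of the poles. -/

section Poles

/-- The rational functions all of whose poles are roots of unity of order at most `m`. -/
def regularSubring (m : ℕ) : Subring (RatFunc ℚ) where
  carrier := {c | ∀ z : ℂ, IsPole c z → ∃ k : ℕ, 1 ≤ k ∧ k ≤ m ∧ IsPrimitiveRoot z k}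
  mul_mem' := by
    intro a b ha hb z hz
    have := Polynomial.aeval_eq_zero_of_dvd_aeval_eq_zero (RatFunc.denom_mul_dvd a b) hz
    rw [map_mul, mul_eq_zero] at this
    exact this.elim (ha z) (hb z)
  one_mem' := by intro z hz; simp [IsPole] at hz
  add_mem' := by
    intro a b ha hb z hz
    have := Polynomial.aeval_eq_zero_of_dvd_aeval_eq_zero (RatFunc.denom_add_dvd a b) hz
    rw [map_mul, mul_eq_zero] at this
    exact this.elim (ha z) (hb z)
  zero_mem' := by intro z hz; simp [IsPole] at hz
  neg_mem' := by
    intro a ha z hz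
    have h := RatFunc.denom_mul_dvd (-1) a
    rw [neg_one_mul, show (-1 : RatFunc ℚ) = algebraMap (Polynomial ℚ) (RatFunc ℚ) (-1) by simp,
      RatFunc.denom_algebraMap, one_mul] at h
    exact ha z (Polynomial.aeval_eq_zero_of_dvd_aeval_eq_zero h hz)

theorem X_mem_regularSubring (m : ℕ) : (RatFunc.X : RatFunc ℚ) ∈ regularSubring m := by
  intro z hz
  simp [IsPole] at hz

theorem inv_X_pow_sub_one_mem_regularSubring {m d : ℕ} (hd : 0 < d) (hdm : d ≤ m) :
    ((RatFunc.X : RatFunc ℚ) ^ d - 1)⁻¹ ∈ regularSubring m := by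
  have heq : (RatFunc.X : RatFunc ℚ) ^ d - 1 =
      algebraMap (Polynomial ℚ) (RatFunc ℚ) (Polynomial.X ^ d - 1) := by simp
  have hne : (RatFunc.X : RatFunc ℚ) ^ d - 1 ≠ 0 := by
    rw [heq]
    exact RatFunc.algebraMap_ne_zero (Polynomial.X_pow_sub_C_ne_zero hd (1 : ℚ))
  intro z hz
  have h := Polynomial.aeval_eq_zero_of_dvd_aeval_eq_zero (RatFunc.denom_inv_dvd hne) hz
  rw [heq, RatFunc.num_algebraMap] at h
  have hz1 : z ^ d = 1 := by simpa [sub_eq_zero] using h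
  have hdvd := orderOf_dvd_of_pow_eq_one hz1
  exact ⟨orderOf z, Nat.pos_of_dvd_of_pos hdvd hd, (Nat.le_of_dvd hd hdvd).trans hdm,
    IsPrimitiveRoot.orderOf z⟩

/-- Once the smaller power is factored out, ±(q^d - 1) remains with d = |a - b| ≤ m. -/
theorem inv_X_zpow_sub_X_zpow {m : ℕ} {a b : ℤ} (ha : 0 ≤ a) (ham : a ≤ m) (hb : 0 ≤ b)
    (hbm : b ≤ m) (hab : a ≠ b) :
    ∃ u ∈ regularSubring m, ((RatFunc.X : RatFunc ℚ) ^ a - RatFunc.X ^ b)⁻¹ =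
      RatFunc.X ^ (-min a b) * u := by
  rcases lt_or_gt_of_ne hab with h | h
  · obtain ⟨d, hd⟩ := Int.eq_ofNat_of_zero_le (sub_nonneg.mpr h.le)
    refine ⟨-(RatFunc.X ^ d - 1)⁻¹,
      neg_mem (inv_X_pow_sub_one_mem_regularSubring (by omega) (by omega)), ?_⟩
    rw [show b = a + d by omega, min_eq_left (by omega), zpow_add₀ RatFunc.X_ne_zero,
      zpow_natCast, zpow_neg, ← inv_neg, ← mul_inv]
    congr 1
    ring
  · obtain ⟨d, hd⟩ := Int.eq_ofNat_of_zero_le (sub_nonneg.mpr h.le)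
    refine ⟨(RatFunc.X ^ d - 1)⁻¹,
      inv_X_pow_sub_one_mem_regularSubring (by omega) (by omega), ?_⟩
    rw [show a = b + d by omega, min_eq_right (by omega), zpow_add₀ RatFunc.X_ne_zero,
      zpow_natCast, zpow_neg, ← mul_inv]
    congr 1
    ring

theorem nodalWeight_X_zpow {ι : Type*} [DecidableEq ι] {m : ℕ} {T : Finset ι} {l : ι → ℤ}
    (h0 : ∀ i, 0 ≤ l i) (hm : ∀ i, l i ≤ m) (hinj : Set.InjOn l T) {i : ι} (hi : i ∈ T) :
    ∃ u ∈ regularSubring m,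
      Lagrange.nodalWeight T (fun i => (RatFunc.X : RatFunc ℚ) ^ l i) i =
        RatFunc.X ^ (-∑ j ∈ T.erase i, min (l i) (l j)) * u := by
  have h : ∀ j ∈ T.erase i, ∃ u ∈ regularSubring m,
      ((RatFunc.X : RatFunc ℚ) ^ l i - RatFunc.X ^ l j)⁻¹ =
        RatFunc.X ^ (-min (l i) (l j)) * u := fun j hj =>
    inv_X_zpow_sub_X_zpow (h0 i) (hm i) (h0 j) (hm j) fun hij =>
      (Finset.ne_of_mem_erase hj) (hinj (Finset.mem_of_mem_erase hj) hi hij.symm)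
  rw [Lagrange.nodalWeight]
  generalize T.erase i = U at h
  induction U using Finset.induction_on with
  | empty => exact ⟨1, one_mem _, by simp⟩
  | insert t U ht ih =>
    obtain ⟨u, hu, hueq⟩ := ih fun j hj => h j (Finset.mem_insert_of_mem hj)
    obtain ⟨w, hw, hweq⟩ := h t (Finset.mem_insert_self _ _)
    refine ⟨w * u, mul_mem hw hu, ?_⟩
    rw [Finset.prod_insert ht, hueq, hweq, Finset.sum_insert ht, neg_add,
      zpow_add₀ RatFunc.X_ne_zero]
    ring

end Poles

/-! ### The q-Ehrhart polynomial, its coefficients and its values. -/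

section EhrhartPolynomial

variable {M : Type*} [AddCommGroup M] {r : ℕ}

/-- The coefficient of `q ^ (n λ(s i))` contributed by a box point to the weighted sum of the
`n`-th dilate. -/
def boxCoeff (s : Fin (r + 1) → M) (lam : Module.Dual ℤ M) (b : (Fin (r + 1) → ℝ) × ℕ × M)
    (i : Fin (r + 1)) : RatFunc ℚ :=
  RatFunc.X ^ lam b.2.2 * ((RatFunc.X ^ lam (s i)) ^ ((cellVertices b.1).card - 1 - b.2.1) *
    Lagrange.nodalWeight (cellVertices b.1) (fun i => RatFunc.X ^ lam (s i)) i)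

theorem IsBoxPoint.lam_eq {s : Fin (r + 1) → M} {b : (Fin (r + 1) → ℝ) × ℕ × M}
    (hb : IsBoxPoint s b) (lam : Module.Dual ℤ M) :
    (lam b.2.2 : ℝ) = ∑ i ∈ cellVertices b.1, b.1 i * lam (s i) := by
  rw [← realForm_latticeEmb, ← hb.2.2.2.2.2, map_sum]
  simp only [map_smul, realForm_latticeEmb, smul_eq_mul]
  exact (Finset.sum_subset (Finset.subset_univ _)
    fun i _ hi => by simp [eq_zero_of_notMem_cellVertices hi]).symm

/-- Write λ_j for `lam (s j)` and b_j for `b.1 j`. The total exponent of q is the sum over j ≠ i of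
b_j λ_j + (1 - b_j) λ_i - min(λ_i, λ_j). Each summand is nonnegative since 0 ≤ b_j ≤ 1, so there is
no pole at q = 0. -/
theorem IsBoxPoint.boxCoeff_mem {s : Fin (r + 1) → M} {b : (Fin (r + 1) → ℝ) × ℕ × M}
    (hb : IsBoxPoint s b) {lam : Module.Dual ℤ M} {m : ℕ} (h0 : ∀ i, 0 ≤ lam (s i))
    (hm : ∀ i, lam (s i) ≤ m)
    (hinj : Set.InjOn (fun i => lam (s i)) (cellVertices b.1 : Set (Fin (r + 1))))
    {i : Fin (r + 1)} (hi : i ∈ cellVertices b.1) :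
    boxCoeff s lam b i ∈ regularSubring m := by
  obtain ⟨u, hu, heq⟩ := nodalWeight_X_zpow (m := m) h0 hm hinj hi
  have hexp : 0 ≤ lam b.2.2 + lam (s i) * ((cellVertices b.1).card - 1 - b.2.1 : ℕ) +
      -∑ j ∈ (cellVertices b.1).erase i, min (lam (s i)) (lam (s j)) := by
    have hlt := hb.height_lt
    have hcard : (((cellVertices b.1).card - 1 - b.2.1 : ℕ) : ℝ) =
        ∑ j ∈ (cellVertices b.1).erase i, (1 : ℝ) - ∑ j ∈ cellVertices b.1, b.1 j := by
      rw [hb.sum_cellVertices, Nat.cast_sub (by omega), ← Finset.card_erase_of_mem hi]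
      simp
    have hreal : (0 : ℝ) ≤ lam b.2.2 +
        lam (s i) * ((cellVertices b.1).card - 1 - b.2.1 : ℕ) +
        -∑ j ∈ (cellVertices b.1).erase i, min (lam (s i) : ℝ) (lam (s j)) := by
      have hsum : (lam b.2.2 : ℝ) + lam (s i) * ((cellVertices b.1).card - 1 - b.2.1 : ℕ) +
          -∑ j ∈ (cellVertices b.1).erase i, min (lam (s i) : ℝ) (lam (s j)) =
          ∑ j ∈ (cellVertices b.1).erase i, (b.1 j * lam (s j) + (1 - b.1 j) * lam (s i) -
            min (lam (s i) : ℝ) (lam (s j))) := by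
        rw [hb.lam_eq lam, hcard, ← Finset.add_sum_erase _ _ hi, ← Finset.add_sum_erase _ _ hi]
        simp only [Finset.sum_sub_distrib, Finset.sum_add_distrib, sub_mul, one_mul,
          ← Finset.sum_mul]
        have hconst : ∑ j ∈ (cellVertices b.1).erase i, (lam (s i) : ℝ) =
            lam (s i) * ∑ j ∈ (cellVertices b.1).erase i, (1 : ℝ) := by
          rw [Finset.mul_sum]; simp
        rw [hconst]
        ring
      rw [hsum]
      refine Finset.sum_nonneg fun j _ => ?_
      have h1 : 0 ≤ b.1 j := hb.1 j
      have h2 := hb.2.2.1 j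
      have h3 := mul_le_mul_of_nonneg_left (min_le_right (lam (s i) : ℝ) (lam (s j))) h1
      have h4 := mul_le_mul_of_nonneg_left (min_le_left (lam (s i) : ℝ) (lam (s j)))
        (sub_nonneg.mpr h2)
      linarith
    exact_mod_cast hreal
  obtain ⟨N, hN⟩ := Int.eq_ofNat_of_zero_le hexp
  have : boxCoeff s lam b i = RatFunc.X ^ N * u := by
    rw [boxCoeff, heq, ← zpow_natCast, ← zpow_natCast RatFunc.X N, ← zpow_mul, ← hN,
      zpow_add₀ RatFunc.X_ne_zero, zpow_add₀ RatFunc.X_ne_zero]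
    ring
  rw [this]
  exact mul_mem (pow_mem (X_mem_regularSubring m) N) hu

variable [Module.Free ℤ M] [Module.Finite ℤ M]

/-- The `q`-Ehrhart polynomial of a point configuration. -/
def qEhrhartPoly (s : Fin (r + 1) → M) (lam : Module.Dual ℤ M) : Polynomial (RatFunc ℚ) :=
  ∑ b ∈ (finite_isBoxPoint s).toFinset, ∑ i ∈ cellVertices b.1,
    Polynomial.C (boxCoeff s lam b i) *
      (1 + Polynomial.C (RatFunc.X - 1) * Polynomial.X) ^ (lam (s i)).toNat

theorem X_sub_one_ne_zero : (RatFunc.X : RatFunc ℚ) - 1 ≠ 0 := by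
  have : (RatFunc.X : RatFunc ℚ) - 1 =
      algebraMap (Polynomial ℚ) (RatFunc ℚ) (Polynomial.X - Polynomial.C 1) := by simp
  rw [this]
  exact RatFunc.algebraMap_ne_zero (Polynomial.X_sub_C_ne_zero 1)

theorem eval_qEhrhartPoly {s : Fin (r + 1) → M} {lam : Module.Dual ℤ M}
    (h0 : ∀ i, 0 ≤ lam (s i))
    (hinj : ∀ B, IsCell (latticeEmb M ∘ s) B → Set.InjOn (fun i => lam (s i)) B) (n : ℕ) :
    (qEhrhartPoly s lam).eval (qInt n) =
      weightedSum lam ((n : ℝ) • convexHull ℝ (Set.range (latticeEmb M ∘ s))) := by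
  rw [weightedSum_eq_sum_box, Finset.sum_filter, qEhrhartPoly, Polynomial.eval_finsetSum]
  refine Finset.sum_congr rfl fun b hb => ?_
  rw [Set.Finite.mem_toFinset] at hb
  have hlt := hb.height_lt
  have hy : Set.InjOn (fun i => (RatFunc.X : RatFunc ℚ) ^ lam (s i)) (cellVertices b.1) := by
    intro i hi j hj hij
    refine hinj _ hb.isCell hi hj ?_
    have := congrArg RatFunc.intDegree hij
    obtain ⟨x, hx⟩ := Int.eq_ofNat_of_zero_le (h0 i)
    obtain ⟨y, hy⟩ := Int.eq_ofNat_of_zero_le (h0 j)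
    have key : ∀ x : ℕ, ((RatFunc.X : RatFunc ℚ) ^ (x : ℤ)).intDegree = x := fun x => by
      rw [zpow_natCast, ← RatFunc.algebraMap_X, ← map_pow, RatFunc.intDegree_polynomial]
      simp
    simp only [hx, hy] at this ⊢
    rw [← key x, this, key]
  have hterm : ∀ i, (Polynomial.C (boxCoeff s lam b i) *
      (1 + Polynomial.C (RatFunc.X - 1) * Polynomial.X) ^ (lam (s i)).toNat).eval (qInt n) =
      RatFunc.X ^ lam b.2.2 *
        ((RatFunc.X ^ lam (s i)) ^ (n + ((cellVertices b.1).card - 1 - b.2.1)) *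
        Lagrange.nodalWeight (cellVertices b.1) (fun i => RatFunc.X ^ lam (s i)) i) := by
    intro i
    have h1 : (1 : RatFunc ℚ) + (RatFunc.X - 1) * qInt n = RatFunc.X ^ n := by
      rw [qInt, mul_div_cancel₀ _ X_sub_one_ne_zero]
      ring
    have h2 : ((RatFunc.X : RatFunc ℚ) ^ n) ^ (lam (s i)).toNat = (RatFunc.X ^ lam (s i)) ^ n := by
      conv_rhs => rw [← Int.toNat_of_nonneg (h0 i), zpow_natCast]
      rw [← pow_mul, ← pow_mul, mul_comm]
    simp only [Polynomial.eval_mul, Polynomial.eval_C, Polynomial.eval_pow, Polynomial.eval_add,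
      Polynomial.eval_one, Polynomial.eval_X, h1, h2, boxCoeff, pow_add]
    ring
  rw [Polynomial.eval_finsetSum]
  simp only [hterm]
  rw [← Finset.mul_sum]
  split_ifs with hn
  · rw [completeHomog_eq_sum ⟨0, zero_mem_cellVertices _⟩ hy,
      show n - b.2.1 + ((cellVertices b.1).card - 1) =
        n + ((cellVertices b.1).card - 1 - b.2.1) by omega]
  -- A box point of height above n should not contribute: the exponent is then below `card - 1`, and
  -- the weighted power sum vanishes.
  · rw [sum_pow_mul_nodalWeight hy (by omega), if_neg (by omega), mul_zero]

end EhrhartPolynomial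

/-! ### The degree, through the valuation at infinity. -/

section Degree

variable {M : Type*} [AddCommGroup M] [Module.Free ℤ M] [Module.Finite ℤ M] {r : ℕ}

theorem natDegree_qEhrhartPoly_le {s : Fin (r + 1) → M} {lam : Module.Dual ℤ M} {m : ℕ}
    (hm : ∀ i, lam (s i) ≤ m) : (qEhrhartPoly s lam).natDegree ≤ m := by
  refine Polynomial.natDegree_sum_le_of_forall_le _ _ fun b _ =>
    Polynomial.natDegree_sum_le_of_forall_le _ _ fun i _ => ?_
  have h1 : (1 + Polynomial.C (RatFunc.X - 1) * Polynomial.X :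
      Polynomial (RatFunc ℚ)).natDegree ≤ 1 := by
    compute_degree
  calc _ ≤ _ := Polynomial.natDegree_C_mul_le _ _
    _ ≤ (lam (s i)).toNat * 1 := Polynomial.natDegree_pow_le_of_le _ h1
    _ ≤ m := by have := hm i; omega

theorem coeff_qEhrhartPoly_mem {s : Fin (r + 1) → M} {lam : Module.Dual ℤ M} {m : ℕ}
    (h0 : ∀ i, 0 ≤ lam (s i)) (hm : ∀ i, lam (s i) ≤ m)
    (hinj : ∀ B, IsCell (latticeEmb M ∘ s) B → Set.InjOn (fun i => lam (s i)) B) (e : ℕ) :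
    (qEhrhartPoly s lam).coeff e ∈ regularSubring m := by
  have hC : ∀ c ∈ regularSubring m,
      (Polynomial.C c : Polynomial (RatFunc ℚ)) ∈ Polynomial.lifts (regularSubring m).subtype :=
    fun c hc => Polynomial.C_mem_lifts (regularSubring m).subtype ⟨c, hc⟩
  have hL : qEhrhartPoly s lam ∈ Polynomial.lifts (regularSubring m).subtype := by
    refine sum_mem fun b hb => sum_mem fun i hi => mul_mem (hC _ ?_) (pow_mem (add_mem (one_mem _)
      (mul_mem (hC _ (sub_mem (X_mem_regularSubring m) (one_mem _)))
        (Polynomial.X_mem_lifts _))) _)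
    rw [Set.Finite.mem_toFinset] at hb
    exact hb.boxCoeff_mem h0 hm (hinj _ hb.isCell) hi
  obtain ⟨c, hc⟩ := (Polynomial.lifts_iff_coeff_lifts _).mp hL e
  rw [← hc]
  exact c.2

open WithZero in
-- All monomials occur with positive coefficients, so the one from the point `n • s i0` cannot
-- cancel.
theorem exp_le_inftyValuation_weightedSum {s : Fin (r + 1) → M} {lam : Module.Dual ℤ M} {m : ℕ}
    (h0 : ∀ i, 0 ≤ lam (s i)) {i0 : Fin (r + 1)} (hi0 : lam (s i0) = m) (n : ℕ) :
    open Classical in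
    exp ((n * m : ℕ) : ℤ) ≤ RatFunc.inftyValuation ℚ
      (weightedSum lam ((n : ℝ) • convexHull ℝ (Set.range (latticeEmb M ∘ s)))) := by
  classical
  have hfin := finite_latticePoints_smul (isLatticePolytope_convexHull_range s) n
  rw [weightedSum, finsum_mem_eq_finite_toFinset_sum _ hfin]
  have hnn : ∀ v ∈ hfin.toFinset, 0 ≤ lam v := by
    intro v hv
    rw [Set.Finite.mem_toFinset] at hv
    obtain ⟨c, hc0, -, hc⟩ := mem_nat_smul_convexHull_range_iff.mp hv
    have h : (lam v : ℝ) = ∑ i, c i * lam (s i) := by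
      rw [← realForm_latticeEmb, ← hc, map_sum]
      simp [realForm_latticeEmb]
    have : (0 : ℝ) ≤ lam v := by
      rw [h]
      exact Finset.sum_nonneg fun i _ => mul_nonneg (hc0 i) (by exact_mod_cast h0 i)
    exact_mod_cast this
  let P : Polynomial ℚ := ∑ v ∈ hfin.toFinset, Polynomial.X ^ (lam v).toNat
  have hP : ∑ v ∈ hfin.toFinset, (RatFunc.X : RatFunc ℚ) ^ lam v =
      algebraMap (Polynomial ℚ) (RatFunc ℚ) P := by
    rw [map_sum]
    refine Finset.sum_congr rfl fun v hv => ?_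
    rw [map_pow, RatFunc.algebraMap_X, ← zpow_natCast, Int.toNat_of_nonneg (hnn v hv)]
  have hmem : n • s i0 ∈ hfin.toFinset := by
    rw [Set.Finite.mem_toFinset]
    refine ⟨latticeEmb M (s i0), subset_convexHull ℝ _ ⟨i0, rfl⟩, ?_⟩
    simp [Nat.cast_smul_eq_nsmul]
  have hcoeff : P.coeff (n * m) ≠ 0 := by
    have : 0 < P.coeff (n * m) := by
      rw [Polynomial.finsetSum_coeff]
      refine Finset.sum_pos' (fun v _ => ?_) ⟨_, hmem, ?_⟩
      · rw [Polynomial.coeff_X_pow]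
        split_ifs <;> simp
      · rw [Polynomial.coeff_X_pow, if_pos]
        · exact one_pos
        · rw [map_nsmul, hi0, nsmul_eq_mul]
          exact_mod_cast rfl
    exact this.ne'
  have hPne : P ≠ 0 := fun h => hcoeff (by simp [h])
  rw [hP, RatFunc.inftyValuation_apply, RatFunc.inftyValuation.polynomial ℚ hPne, exp_le_exp]
  exact_mod_cast Polynomial.le_natDegree_of_ne_zero hcoeff

open WithZero in
theorem inftyValuation_qInt_le (n : ℕ) :
    open Classical in RatFunc.inftyValuation ℚ (qInt n) ≤ exp (n : ℤ) := by
  classical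
  have h : qInt n = ∑ i ∈ Finset.range n, (RatFunc.X : RatFunc ℚ) ^ i := by
    rw [geom_sum_eq (sub_ne_zero.mp X_sub_one_ne_zero), qInt]
  rw [h]
  refine Valuation.map_sum_le _ fun i hi => ?_
  rw [map_pow, RatFunc.inftyValuation.X, ← exp_nsmul, exp_le_exp]
  have := Finset.mem_range.mp hi
  simp only [nsmul_eq_mul, mul_one]
  omega

open WithZero in
/-- A polynomial over `ℚ(q)` whose value at `[n]_q` has degree at least `n m` in `q` for every `n`
has degree at least `m`. -/
theorem le_degree_of_exp_le_inftyValuation {L : Polynomial (RatFunc ℚ)} {m : ℕ}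
    (h : ∀ n : ℕ, open Classical in
      exp ((n * m : ℕ) : ℤ) ≤ RatFunc.inftyValuation ℚ (L.eval (qInt n))) :
    (m : WithBot ℕ) ≤ L.degree := by
  classical
  by_contra! hlt
  have hN : ∀ i, ∃ N : ℕ, RatFunc.inftyValuation ℚ (L.coeff i) ≤ exp (N : ℤ) := by
    intro i
    by_cases hz : L.coeff i = 0
    · exact ⟨0, by simp [hz]⟩
    · refine ⟨(L.coeff i).intDegree.toNat, ?_⟩
      rw [RatFunc.inftyValuation_apply, RatFunc.inftyValuation_of_nonzero ℚ hz, exp_le_exp]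
      exact Int.self_le_toNat _
  choose N hN using hN
  set D := ∑ i ∈ Finset.range m, N i with hD
  -- `D` bounds the q-degrees of the coefficients below index `m`; this `n` gives D + n(m-1) < nm.
  set n := D + 1 with hn
  have hle : RatFunc.inftyValuation ℚ (L.eval (qInt n)) ≤ exp (D + n * ((m : ℤ) - 1)) := by
    rw [Polynomial.eval_eq_sum, Polynomial.sum]
    refine Valuation.map_sum_le _ fun i hi => ?_
    have him : i < m := by
      exact_mod_cast (Polynomial.le_degree_of_mem_supp i hi).trans_lt hlt
    have hNi : N i ≤ D :=
      Finset.single_le_sum (fun _ _ => Nat.zero_le _) (Finset.mem_range.mpr him)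
    rw [map_mul, map_pow]
    calc _ ≤ exp (N i : ℤ) * exp (n : ℤ) ^ i :=
          mul_le_mul' (hN i) (pow_le_pow_left' (inftyValuation_qInt_le n) i)
      _ = exp (N i + i * n : ℤ) := by rw [← exp_nsmul, ← exp_add, nsmul_eq_mul]
      _ ≤ _ := by
        rw [exp_le_exp]
        have : (i : ℤ) ≤ m - 1 := by omega
        have := mul_le_mul_of_nonneg_left this (Int.natCast_nonneg n)
        have : (N i : ℤ) ≤ D := by exact_mod_cast hNi
        linarith
  have := (h n).trans hle
  rw [exp_le_exp] at this
  push_cast [hn] at this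
  linarith

end Degree

end QEhrhart

/-! ### The main theorem. -/

theorem theorem2p1 {M : Type*} [AddCommGroup M] [Module.Free ℤ M] [Module.Finite ℤ M]
    (Q : Set (ℝ ⊗[ℤ] M)) (lam : Module.Dual ℤ M)
    (hQ : QEhrhart.IsLatticePolytope Q)
    (hpos : QEhrhart.Positivity Q lam) (hgen : QEhrhart.Genericity Q lam) :
    ∃ m : ℕ, IsGreatest (QEhrhart.realForm lam '' Q) (m : ℝ) ∧
      ∃ L : Polynomial (RatFunc ℚ),
        (∀ n : ℕ, L.eval (QEhrhart.qInt n) = QEhrhart.weightedSum lam ((n : ℝ) • Q)) ∧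
        L.degree = (m : WithBot ℕ) ∧
        ∀ (i : ℕ) (z : ℂ), QEhrhart.IsPole (L.coeff i) z →
          ∃ k : ℕ, 1 ≤ k ∧ k ≤ m ∧ IsPrimitiveRoot z k := by
  obtain ⟨S, hS, rfl⟩ := hQ
  obtain ⟨r, hr⟩ : ∃ r, S.card = r + 1 := ⟨S.card - 1, by have := hS.card_pos; omega⟩
  let e : S ≃ Fin (r + 1) := S.equivFinOfCardEq hr
  -- Sorting by λ makes the pulling order compatible with λ, with the minimum at index 0 and the
  -- maximum m at the last index.
  let σ := Tuple.sort fun i => lam (e.symm i).1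
  let s : Fin (r + 1) → M := fun i => (e.symm (σ i)).1
  have hs : Function.Injective s := fun i j hij => by
    simpa using Subtype.ext hij
  have hmono : Monotone fun i => lam (s i) := Tuple.monotone_sort fun i => lam (e.symm i).1
  have hrange : QEhrhart.latticeEmb M '' (S : Set M) = Set.range (QEhrhart.latticeEmb M ∘ s) := by
    rw [Set.range_comp]
    congr 1
    ext v
    refine ⟨fun hv => ⟨σ.symm (e ⟨v, hv⟩), by simp [s]⟩, ?_⟩
    rintro ⟨i, rfl⟩
    exact (e.symm (σ i)).2
  rw [hrange] at hpos hgen ⊢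
  have hp : Function.Injective (QEhrhart.latticeEmb M ∘ s) :=
    QEhrhart.latticeEmb_injective.comp hs
  have hval : ∀ i, QEhrhart.realForm lam ((QEhrhart.latticeEmb M ∘ s) i) = lam (s i) :=
    fun i => QEhrhart.realForm_latticeEmb lam (s i)
  have hmono' : Monotone fun i => QEhrhart.realForm lam ((QEhrhart.latticeEmb M ∘ s) i) :=
    fun i j hij => by
      simp only [hval]
      exact_mod_cast hmono hij
  have hgen' : QEhrhart.IsGenericOn (QEhrhart.latticeEmb M ∘ s) (QEhrhart.realForm lam) :=
    fun x y hxy hext => hgen x y ⟨hxy, hext⟩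
  have h0 : ∀ i, 0 ≤ lam (s i) := by
    intro i
    have h := hpos _ (QEhrhart.apply_zero_mem_extremePoints hp hgen' hmono')
    rw [hval] at h
    exact le_trans (by exact_mod_cast h) (hmono (Fin.zero_le i))
  obtain ⟨m, hm⟩ := Int.eq_ofNat_of_zero_le (h0 (Fin.last r))
  have hle : ∀ i, lam (s i) ≤ m := fun i => hm ▸ hmono (Fin.le_last i)
  have hinj : ∀ B, QEhrhart.IsCell (QEhrhart.latticeEmb M ∘ s) B →
      Set.InjOn (fun i => lam (s i)) B := fun B hB i hi j hj hij =>
    hB.injOn hp hgen' hmono' hi hj (by simp only [hval]; exact_mod_cast hij)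
  refine ⟨m, ⟨⟨_, subset_convexHull ℝ _ ⟨Fin.last r, rfl⟩, by rw [hval, hm]; simp⟩, ?_⟩,
    QEhrhart.qEhrhartPoly s lam, QEhrhart.eval_qEhrhartPoly h0 hinj, le_antisymm ?_ ?_, ?_⟩
  · rintro _ ⟨x, hx, rfl⟩
    refine convexHull_min (t := (QEhrhart.realForm lam) ⁻¹' Set.Iic (m : ℝ)) ?_
      ((convex_Iic _).linear_preimage _) hx
    rintro _ ⟨i, rfl⟩
    rw [Set.mem_preimage, Set.mem_Iic, hval]
    exact_mod_cast hle i
  · exact Polynomial.natDegree_le_iff_degree_le.mp (QEhrhart.natDegree_qEhrhartPoly_le hle)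
  · refine QEhrhart.le_degree_of_exp_le_inftyValuation fun n => ?_
    rw [QEhrhart.eval_qEhrhartPoly h0 hinj]
    exact QEhrhart.exp_le_inftyValuation_weightedSum h0 hm n
  · exact fun i z hz => QEhrhart.coeff_qEhrhartPoly_mem h0 hle hinj i z hz

end
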